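/- **Setting.** Let $\Gamma$ be a Coxeter graph with (finite or infinite) vertex set $S$ and Coxeter matrix $M=(m_{s,t})_{s,t\in S}$, let $(W,S)$ be its Coxeter system, and let $\mathbb K$ be a field. A *symmetry* of $\Gamma$ is a permutation $g$ of $S$ with $m_{g(s),g(t)}=m_{s,t}$ for all $s,t$; let $G$ be a subgroup of the group $\mathrm{Sym}(\Gamma)$ of symmetries. It acts on $W$, and $W^G$ denotes the subgroup of fixed elements. For $X\subset S$ let $W_X$ be the subgroup of $W$ generated by $X$. A *reduced root basis* of $\Gamma$ is a family $\mathbf B=(\sigma_s)_{s\in S}$ of linear reflections of $V=\bigoplus_{s\in S}\mathbb R\alpha_s$ such that: $\sigma_s(\alpha_s)=-\alpha_s$ for all $s$; $\sigma_s\sigma_t$ has order $m_{s,t}$ for all $s,t$ (so that $W$ acts on $V$, with $s$ acting by $\sigma_s$); the set $\Phi=\{w(\alpha_s)\mid w\in W,\ s\in S\}$ is the disjoint union of the set $\Phi^+$ of its elements with all coordinates $\ge 0$ and the set $\Phi^-$ of its elements with all coordinates $\le 0$; and $\mathbb R\alpha_s\cap\Phi=\{\pm\alpha_s\}$ for all $s$.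 Let $G$ act on $V$ by $g(\alpha_s)=\alpha_{g(s)}$. One says that $\mathbf B$ is *symmetric with respect to $G$* if $\sigma_{g(s)}=g\sigma_sg^{-1}$ for all $g\in G$, $s\in S$; then $G$ acts on $\Phi^+$. **The $\hat\Phi^+$-basis property.** Let $\mathbf B$ be a reduced root basis of $\Gamma$, symmetric with respect to $G$. Let $E$ be the $\mathbb K$-vector space with basis $\{e_\beta\mid\beta\in\Phi^+\}$, on which $G$ acts by $g(e_\beta)=e_{g(\beta)}$, and let $E^G$ be its subspace of fixed vectors. Let $\mathcal S$ be the set of finite orbits $X$ of $S$ under $G$ such that $W_X$ is finite; for $X\in\mathcal S$ let $u_X$ be the longest element of $W_X$, and put $\hat\alpha_X=\sum_{s\in X}\alpha_s$ and $\omega_X=\{\alpha_s\mid s\in X\}$. Let $\hat\Phi=\{w(\hat\alpha_X)\mid X\in\mathcal S,\ w\in\langle u_Y\mid Y\in\mathcal S\rangle\}$, and let $\hat\Phi^+$ be the set of elements of $\hat\Phi$ that are linear combinations of the $\hat\alpha_X$, $X\in\mathcal S$, with nonnegative coefficients. For $\hat\alpha\in\hat\Phi^+$ write $\hat\alpha=w(\hat\alpha_X)$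 with $w\in W^G$, $X\in\mathcal S$, and put $F(\hat\alpha)=w(\omega_X)$; this is a finite $G$-orbit in $\Phi^+$ that does not depend on the choice of $w$ and $X$. For a finite subset $\omega$ of $\Phi^+$ put $\hat e_\omega=\sum_{\beta\in\omega}e_\beta$. The pair $(\Gamma,G)$ has the *$\hat\Phi^+$-basis property* (over $\mathbb K$, with respect to $\mathbf B$) if $\hat{\mathcal B}=\{\hat e_{F(\hat\alpha)}\mid\hat\alpha\in\hat\Phi^+\}$ is a basis of $E^G$. **Theorem 2.9.** Let $\Gamma$, $G$, $\mathbb K$ be as above. Let $S_{\mathrm{fin}}$ be the union of the finite orbits of $S$ under $G$, let $\Gamma_{\mathrm{fin}}$ be the full subgraph of $\Gamma$ spanned by $S_{\mathrm{fin}}$, and let $G_{\mathrm{fin}}$ be the subgroup of $\mathrm{Sym}(\Gamma_{\mathrm{fin}})$ formed by the symmetries of $\Gamma_{\mathrm{fin}}$ induced by the elements of $G$. Let $\mathbf B$ be any reduced root basis of $\Gamma$ that is symmetric with respect to $G$, and $\mathbf B'$ any reduced root basis of $\Gamma_{\mathrm{fin}}$ that is symmetric with respect to $G_{\mathrm{fin}}$.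 Then $(\Gamma,G)$ has the $\hat\Phi^+$-basis property (with respect to $\mathbf B$) if and only if $(\Gamma_{\mathrm{fin}},G_{\mathrm{fin}})$ has the $\hat\Phi^+$-basis property (with respect to $\mathbf B'$). -/

import Mathlib

noncomputable section

namespace CoxeterSymmetry

universe u v

/-! Coxeter graphs are encoded by their Coxeter matrices (Mathlib's `CoxeterMatrix`, where the
entry `0` stands for `∞`); the Coxeter group of `M` is Mathlib's `M.Group`, with generators
`M.simple s`, `s : S`. -/

section Symmetries

variable {S : Type u}

/-- The group of symmetries of the Coxeter graph: the permutations of the vertex set which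
preserve the Coxeter matrix. -/
def symmetryGroup (M : CoxeterMatrix S) : Subgroup (Equiv.Perm S) where
  carrier := {g | ∀ s t, M (g s) (g t) = M s t}
  mul_mem' := by
    intro g h hg hh s t
    rw [Equiv.Perm.mul_apply, Equiv.Perm.mul_apply, hg, hh]
  one_mem' := fun _ _ => rfl
  inv_mem' := by
    intro g hg s t
    have h := hg (g⁻¹ s) (g⁻¹ t)
    rw [show g (g⁻¹ s) = s from g.apply_symm_apply s,
      show g (g⁻¹ t) = t from g.apply_symm_apply t] at h
    exact h.symm

/-- The Coxeter matrix of the full subgraph spanned by a set `X` of vertices. -/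
def fullSubgraph (M : CoxeterMatrix S) (X : Set S) : CoxeterMatrix X where
  M := fun s t => M s t
  isSymm := by
    ext s t
    exact M.symmetric t s
  diagonal := fun s => M.diagonal s
  off_diagonal := fun s t h => M.off_diagonal s t (fun h' => h (Subtype.ext h'))

variable {M : CoxeterMatrix S}

/-- The automorphism of the Coxeter group induced by a symmetry `g`, as an endomorphism; it sends
the generator `s` to the generator `g s`. -/
def groupAction (g : symmetryGroup M) : M.Group →* M.Group :=
  M.toCoxeterSystem.lift ⟨fun s => M.simple ((g : Equiv.Perm S) s), by
    intro s t
    have h := M.toCoxeterSystem.simple_mul_simple_pow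
      ((g : Equiv.Perm S) s) ((g : Equiv.Perm S) t)
    rw [g.2 s t] at h
    exact h⟩

theorem groupAction_simple (g : symmetryGroup M) (s : S) :
    groupAction g (M.simple s) = M.simple ((g : Equiv.Perm S) s) :=
  M.toCoxeterSystem.lift_apply_simple _ s

/-- `W^G`, the subgroup of the elements of the Coxeter group that are fixed by `G`. -/
def fixedSubgroup (G : Subgroup (symmetryGroup M)) : Subgroup M.Group where
  carrier := {w | ∀ g ∈ G, groupAction g w = w}
  mul_mem' := by
    intro a b ha hb g hg
    rw [map_mul, ha g hg, hb g hg]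
  one_mem' := fun _ _ => map_one _
  inv_mem' := by
    intro a ha g hg
    rw [map_inv, ha g hg]

/-- `W_X`, the subgroup of the Coxeter group generated by `X`. -/
def standardParabolic (M : CoxeterMatrix S) (X : Set S) : Subgroup M.Group :=
  Subgroup.closure (M.simple '' X)

/-- The finite orbits `X` of `G` on the vertex set such that `W_X` is finite. -/
def admissibleOrbits (G : Subgroup (symmetryGroup M)) : Set (Finset S) :=
  {X | (∃ s : S, (X : Set S) = MulAction.orbit G s) ∧
    ((standardParabolic M (X : Set S) : Subgroup M.Group) : Set M.Group).Finite}

/-- `u` is the longest element of `W_X`: it lies in `W_X` and every `s ∈ X` shortens it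
(the word length on `W_X` with respect to `X` is the restriction of the word length on `W`). -/
def IsLongestElement (M : CoxeterMatrix S) (X : Set S) (u : M.Group) : Prop :=
  u ∈ standardParabolic M X ∧
    ∀ s ∈ X, M.toCoxeterSystem.length (M.simple s * u) < M.toCoxeterSystem.length u

/-- The subgroup of the Coxeter group generated by the longest elements `u_X`, where `X` runs
over the admissible orbits. -/
def longestSubgroup (G : Subgroup (symmetryGroup M)) : Subgroup M.Group :=
  Subgroup.closure {u | ∃ X ∈ admissibleOrbits G, IsLongestElement M (X : Set S) u}

/-- `S_fin`, the union of the finite orbits of `G` on the vertex set. -/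
def finVertices (G : Subgroup (symmetryGroup M)) : Set S :=
  {s | (MulAction.orbit G s).Finite}

/-- `Γ_fin`, the full subgraph spanned by `S_fin`. -/
abbrev finGraph (G : Subgroup (symmetryGroup M)) : CoxeterMatrix (finVertices G) :=
  fullSubgraph M (finVertices G)

/-- `G_fin`, the group of the symmetries of `Γ_fin` that are induced by elements of `G`. -/
def finGroup (G : Subgroup (symmetryGroup M)) : Subgroup (symmetryGroup (finGraph G)) where
  carrier := {h | ∃ g ∈ G, ∀ s : finVertices G,
    (((h : Equiv.Perm (finVertices G)) s : finVertices G) : S) = (g : Equiv.Perm S) s}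
  mul_mem' := by
    rintro a b ⟨g, hg, ha⟩ ⟨k, hk, hb⟩
    refine ⟨g * k, G.mul_mem hg hk, fun s => ?_⟩
    rw [Subgroup.coe_mul, Subgroup.coe_mul, Equiv.Perm.mul_apply, Equiv.Perm.mul_apply, ha, hb]
  one_mem' := ⟨1, G.one_mem, fun _ => rfl⟩
  inv_mem' := by
    rintro a ⟨g, hg, ha⟩
    refine ⟨g⁻¹, G.inv_mem hg, fun s => ?_⟩
    have h := ha ((a : Equiv.Perm (finVertices G))⁻¹ s)
    rw [show (a : Equiv.Perm (finVertices G)) ((a : Equiv.Perm (finVertices G))⁻¹ s) = s from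
      (a : Equiv.Perm (finVertices G)).apply_symm_apply s] at h
    rw [Subgroup.coe_inv, Subgroup.coe_inv, h]
    exact ((g : Equiv.Perm S).symm_apply_apply _).symm

end Symmetries

section RootBases

variable {S : Type u} {M : CoxeterMatrix S}

/-- The basis vector `α_s` of `V = ⊕_{s ∈ S} ℝ α_s`. -/
def simpleRoot (s : S) : S →₀ ℝ := Finsupp.single s 1

/-- A root prebasis with Coxeter matrix `M`: a linear reflection `σ_s` of `V = ⊕ ℝ α_s` with
`σ_s (α_s) = -α_s` for each `s`, such that `σ_s σ_t` has order `M s t` (an infinite order being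
encoded by `0`). The reflection is given by the linear form `φ_s` with `φ_s (α_s) = 2` and
`σ_s (x) = x - φ_s (x) α_s`. -/
structure RootPrebasis (M : CoxeterMatrix S) where
  /-- The linear form defining the reflection `σ_s`. -/
  form : S → Module.Dual ℝ (S →₀ ℝ)
  form_self : ∀ s, form s (simpleRoot s) = 2
  orderOf_mul : ∀ s t,
    orderOf (Module.reflection (form_self s) * Module.reflection (form_self t)) = M s t

/-- The permutation action of a symmetry on `V`, sending `α_s` to `α_{g s}`. -/
def spaceAction (g : symmetryGroup M) : (S →₀ ℝ) ≃ₗ[ℝ] (S →₀ ℝ) :=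
  Finsupp.domLCongr (g : Equiv.Perm S)

/-- `α̂_X = ∑_{s ∈ X} α_s`. -/
def hatSimpleRoot (X : Finset S) : S →₀ ℝ := ∑ s ∈ X, simpleRoot s

namespace RootPrebasis

variable (B : RootPrebasis M)

/-- The reflection `σ_s`. -/
def reflection (s : S) : (S →₀ ℝ) ≃ₗ[ℝ] (S →₀ ℝ) := Module.reflection (B.form_self s)

/-- The linear representation of the Coxeter group on `V` which sends `s` to `σ_s`. -/
def rep : M.Group →* ((S →₀ ℝ) ≃ₗ[ℝ] (S →₀ ℝ)) :=
  M.toCoxeterSystem.lift ⟨B.reflection, by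
    intro s t
    rw [← B.orderOf_mul s t]
    exact pow_orderOf_eq_one _⟩

theorem rep_simple (s : S) : B.rep (M.simple s) = B.reflection s :=
  M.toCoxeterSystem.lift_apply_simple _ s

/-- `Φ`, the set of the vectors `w (α_s)`. -/
def roots : Set (S →₀ ℝ) := {β | ∃ (w : M.Group) (s : S), β = B.rep w (simpleRoot s)}

/-- `Φ⁺`. -/
def posRoots : Set (S →₀ ℝ) := {β | β ∈ B.roots ∧ ∀ s, 0 ≤ β s}

/-- `Φ⁻`. -/
def negRoots : Set (S →₀ ℝ) := {β | β ∈ B.roots ∧ ∀ s, β s ≤ 0}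

/-- A prebasis is a root basis if `Φ` is the disjoint union of `Φ⁺` and `Φ⁻`. -/
def IsRootBasis : Prop := B.roots = B.posRoots ∪ B.negRoots ∧ Disjoint B.posRoots B.negRoots

/-- A root basis is reduced if the only roots in `ℝ α_s` are `± α_s`, for every `s`. -/
def IsReduced : Prop :=
  B.IsRootBasis ∧ ∀ s : S,
    ((Submodule.span ℝ {simpleRoot s} : Submodule ℝ (S →₀ ℝ)) : Set (S →₀ ℝ)) ∩ B.roots =
      {simpleRoot s, -simpleRoot s}

/-- `B` is symmetric with respect to `G` if `σ_{g s} = g σ_s g⁻¹` for all `g ∈ G`, `s ∈ S`. -/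
def IsSymmetric (G : Subgroup (symmetryGroup M)) : Prop :=
  ∀ g ∈ G, ∀ s : S, B.reflection ((g : Equiv.Perm S) s) =
    spaceAction g * B.reflection s * (spaceAction g)⁻¹

variable {B} {G : Subgroup (symmetryGroup M)}

theorem IsSymmetric.rep_equivariant (hB : B.IsSymmetric G) {g : symmetryGroup M} (hg : g ∈ G)
    (w : M.Group) :
    B.rep (groupAction g w) = spaceAction g * B.rep w * (spaceAction g)⁻¹ := by
  have h : B.rep.comp (groupAction g) =
      (MulAut.conj (spaceAction g)).toMonoidHom.comp B.rep := by
    refine M.toCoxeterSystem.ext_simple fun s => ?_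
    change B.rep (groupAction g (M.simple s)) =
      spaceAction g * B.rep (M.simple s) * (spaceAction g)⁻¹
    rw [groupAction_simple, rep_simple, rep_simple, hB g hg s]
  exact DFunLike.congr_fun h w

theorem IsSymmetric.spaceAction_mem_posRoots (hB : B.IsSymmetric G) {g : symmetryGroup M}
    (hg : g ∈ G) {β : S →₀ ℝ} (hβ : β ∈ B.posRoots) : spaceAction g β ∈ B.posRoots := by
  obtain ⟨⟨w, s, rfl⟩, hpos⟩ := hβ
  refine ⟨⟨groupAction g w, (g : Equiv.Perm S) s, ?_⟩, fun t => hpos _⟩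
  have h : simpleRoot ((g : Equiv.Perm S) s) = spaceAction g (simpleRoot s) := by
    simp [simpleRoot, spaceAction]
  rw [hB.rep_equivariant hg, h]
  change _ = (spaceAction g) ((B.rep w) ((spaceAction g)⁻¹ ((spaceAction g) (simpleRoot s))))
  rw [← LinearEquiv.mul_apply (spaceAction g)⁻¹, inv_mul_cancel, LinearEquiv.coe_one, id]

/-- The action of `G` on `Φ⁺`. -/
def posRootAction (hB : B.IsSymmetric G) (g : G) (β : B.posRoots) : B.posRoots :=
  ⟨spaceAction (g : symmetryGroup M) β, hB.spaceAction_mem_posRoots g.2 β.2⟩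

/-- `E^G`, where `E` is the `K`-vector space with basis `(e_β)` indexed by `Φ⁺`, on which `G` acts
by `g e_β = e_{g β}`. -/
def fixedSpace (K : Type v) [Field K] (hB : B.IsSymmetric G) : Submodule K (B.posRoots →₀ K) :=
  ⨅ g : G, LinearMap.eqLocus (Finsupp.lmapDomain K K (posRootAction hB g)) LinearMap.id

variable (B) (G)

/-- `Φ̂`, the root system of the equivariant root basis of `B / G`. The vectors `α̂_X`, `X` an
admissible orbit, are a basis of a subspace `V̂` of `V`, the reflection `σ̂_X` of `V̂` is the
restriction of `u_X`, and the roots are the images of the `α̂_X` under the group generated by the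
reflections. -/
def hatRoots : Set (S →₀ ℝ) :=
  {v | ∃ w ∈ longestSubgroup G, ∃ X ∈ admissibleOrbits G, v = B.rep w (hatSimpleRoot X)}

/-- `Φ̂⁺`, the roots in `Φ̂` whose coordinates in the basis `(α̂_X)` of `V̂` are all
nonnegative. -/
def hatPosRoots : Set (S →₀ ℝ) :=
  {v | v ∈ B.hatRoots G ∧ ∃ c : admissibleOrbits G →₀ ℝ, (∀ X, 0 ≤ c X) ∧
    v = c.sum fun X a => a • hatSimpleRoot (X : Finset S)}

/-- The graph of the map `F` from `Φ̂⁺` to the set of finite orbits of `G` on `Φ⁺`: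
`F (w (α̂_X)) = w (ω_X)` with `ω_X = {α_s | s ∈ X}`, for `w ∈ W^G` and `X` an admissible orbit. -/
def FGraph (v : S →₀ ℝ) (ω : Finset B.posRoots) : Prop :=
  v ∈ B.hatPosRoots G ∧ ∃ w ∈ fixedSubgroup G, ∃ X ∈ admissibleOrbits G,
    v = B.rep w (hatSimpleRoot X) ∧
    (Subtype.val '' (ω : Set B.posRoots)) = (fun s => B.rep w (simpleRoot s)) '' (X : Set S)

/-- `B̂ = {ê_{F(v)} | v ∈ Φ̂⁺}`, where `ê_ω = ∑_{β ∈ ω} e_β`. -/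
def hatFamily (K : Type v) [Field K] : Set (B.posRoots →₀ K) :=
  {x | ∃ (v : S →₀ ℝ) (ω : Finset B.posRoots), B.FGraph G v ω ∧
    x = ∑ β ∈ ω, Finsupp.single β (1 : K)}

variable {B} {G}

/-- The `Φ̂⁺`-basis property: `B̂` is a basis of `E^G`. -/
def HasBasisProperty (K : Type v) [Field K] (hB : B.IsSymmetric G) : Prop :=
  LinearIndependent K (Subtype.val : B.hatFamily G K → (B.posRoots →₀ K)) ∧
    Submodule.span K (B.hatFamily G K) = fixedSpace K hB

end RootPrebasis

end RootBases

end CoxeterSymmetry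

end

/-!
The basis property is first freed from the root basis. The vectors `ê_ω`, where `ω` runs over the
finite `G`-orbits in `Φ⁺`, form a basis of `E^G`, and the values of `F` are such orbits; hence the
basis property says that every finite orbit of positive roots is a value of `F`
(`hasBasisProperty_iff`). Positive roots correspond `G`-equivariantly to the reflections of `W`
(`conj_eq_conj_iff`), and `W^G` is generated by the longest elements `u_X`
(`fixedSubgroup_eq_longestSubgroup`), so that this becomes a statement on the Coxeter group alone:
every reflection with a finite `G`-orbit is conjugate under `W^G` to some `s ∈ X`, with `X` a finite
orbit such that `W_X` is finite (`FiniteOrbitReflectionsFold`).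

This statement is the same for `Γ` and for `Γ_fin`, since all that it mentions lives in the subgroup
`W_{S_fin}`, which is the Coxeter group of `Γ_fin`: the admissible orbits lie in `S_fin`, the
longest elements generating `W^G` lie in `W_{S_fin}`, and a positive root with a finite orbit has
its support in `S_fin`, so that it is a root of `W_{S_fin}` (`finiteOrbitReflectionsFold_iff`).

What this uses of Coxeter groups is derived from the given root basis, whose reflections need not
preserve a bilinear form. The main point is that `w (α_s)` is positive when `s` does not shorten
`w` on the right (`rep_map_nonneg`). The proof splits off from `w` its alternating tail in `s` and
another generator `t`, and the case of an alternating word rests on two facts: `α_s` is the only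
positive root that `σ_s` makes negative, and `w (α_s) = α_t` implies `w σ_s w⁻¹ = σ_t`
(`rep_conj_eq`). It follows that the representation is faithful, that the Coxeter group of a full
subgraph embeds into `W`, and that `W_X` consists of the elements that act trivially on `V / V_X`
(`mem_standardParabolic`).
-/

noncomputable section

namespace CoxeterSymmetry

open CoxeterSystem

/-! ### Roots and simple reflections -/

namespace RootPrebasis

variable {S : Type*} {M : CoxeterMatrix S} {B : RootPrebasis M}

theorem reflection_apply (B : RootPrebasis M) (s : S) (x : S →₀ ℝ) :
    B.reflection s x = x - B.form s x • simpleRoot s :=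
  Module.reflection_apply _ _

theorem reflection_simpleRoot (B : RootPrebasis M) (s : S) :
    B.reflection s (simpleRoot s) = -simpleRoot s :=
  Module.reflection_apply_self _

theorem rep_mul_apply (B : RootPrebasis M) (v w : M.Group) (x : S →₀ ℝ) :
    B.rep (v * w) x = B.rep v (B.rep w x) := by
  rw [map_mul]; rfl

theorem rep_inv_apply_apply (B : RootPrebasis M) (w : M.Group) (x : S →₀ ℝ) :
    B.rep w⁻¹ (B.rep w x) = x := by
  rw [← rep_mul_apply, inv_mul_cancel, map_one]; rfl

theorem rep_apply_inv_apply (B : RootPrebasis M) (w : M.Group) (x : S →₀ ℝ) :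
    B.rep w (B.rep w⁻¹ x) = x := by
  rw [← rep_mul_apply, mul_inv_cancel, map_one]; rfl

theorem simpleRoot_apply_self (s : S) : simpleRoot s s = 1 := by simp [simpleRoot]

theorem simpleRoot_apply_of_ne {s t : S} (h : t ≠ s) : simpleRoot s t = 0 := by
  simp [simpleRoot, h.symm]

theorem simpleRoot_nonneg (s : S) : 0 ≤ simpleRoot s := by
  simp [simpleRoot]

theorem simpleRoot_ne_zero (s : S) : simpleRoot s ≠ 0 := by simp [simpleRoot]

theorem simpleRoot_mem_roots (B : RootPrebasis M) (s : S) : simpleRoot s ∈ B.roots :=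
  ⟨1, s, by rw [map_one]; rfl⟩

theorem rep_mem_roots (w : M.Group) {β : S →₀ ℝ} (hβ : β ∈ B.roots) : B.rep w β ∈ B.roots := by
  obtain ⟨v, s, rfl⟩ := hβ
  exact ⟨w * v, s, (B.rep_mul_apply _ _ _).symm⟩

theorem rep_simpleRoot_mem_roots (B : RootPrebasis M) (w : M.Group) (s : S) :
    B.rep w (simpleRoot s) ∈ B.roots :=
  ⟨w, s, rfl⟩

theorem reflection_mem_roots (s : S) {β : S →₀ ℝ} (hβ : β ∈ B.roots) :
    B.reflection s β ∈ B.roots := by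
  rw [← rep_simple]; exact rep_mem_roots _ hβ

theorem ne_zero_of_mem_roots {β : S →₀ ℝ} (hβ : β ∈ B.roots) : β ≠ 0 := by
  obtain ⟨v, s, rfl⟩ := hβ
  simpa using simpleRoot_ne_zero s

theorem IsReduced.nonneg_or_nonpos (h : B.IsReduced) {β : S →₀ ℝ} (hβ : β ∈ B.roots) :
    0 ≤ β ∨ β ≤ 0 := by
  rw [h.1.1] at hβ
  exact hβ.imp (fun h => h.2) (fun h => h.2)

theorem IsReduced.nonneg_of_pos (h : B.IsReduced) {β : S →₀ ℝ} (hβ : β ∈ B.roots) {r : S}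
    (hr : 0 < β r) : 0 ≤ β :=
  (h.nonneg_or_nonpos hβ).resolve_right fun hn => absurd (hn r) (not_le.2 hr)

theorem not_nonpos_of_nonneg {β : S →₀ ℝ} (hβ : β ∈ B.roots) (h0 : 0 ≤ β) : ¬ β ≤ 0 :=
  fun h => ne_zero_of_mem_roots hβ (le_antisymm h h0)

/-- A root proportional to a simple root is that simple root or its opposite, since the root basis
is reduced. -/
theorem IsReduced.eq_or_eq_neg (h : B.IsReduced) {s : S} {c : ℝ}
    (hc : c • simpleRoot s ∈ B.roots) :
    c • simpleRoot s = simpleRoot s ∨ c • simpleRoot s = -simpleRoot s := by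
  have : c • simpleRoot s ∈
      ((Submodule.span ℝ {simpleRoot s} : Submodule ℝ (S →₀ ℝ)) : Set (S →₀ ℝ)) ∩ B.roots :=
    ⟨Submodule.mem_span_singleton.2 ⟨c, rfl⟩, hc⟩
  rwa [h.2 s] at this

/-- The only positive root that `σ_s` makes negative is `α_s`. -/
theorem IsReduced.eq_simpleRoot_of_reflection_not_nonneg (h : B.IsReduced) {β : S →₀ ℝ}
    (hβ : β ∈ B.roots) (h0 : 0 ≤ β) {s : S} (hs : ¬ 0 ≤ B.reflection s β) :
    β = simpleRoot s := by
  have h1 := (h.nonneg_or_nonpos (reflection_mem_roots s hβ)).resolve_left hs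
  have h2 : β = β s • simpleRoot s := by
    ext r
    by_cases hr : r = s
    · subst hr; simp [simpleRoot_apply_self]
    · have h3 := h1 r
      rw [reflection_apply] at h3
      have h4 := h0 r
      simp only [Finsupp.coe_sub, Finsupp.coe_smul, Pi.sub_apply, Pi.smul_apply,
        simpleRoot_apply_of_ne hr, smul_zero, sub_zero, Finsupp.coe_zero, Pi.zero_apply] at h3 h4 ⊢
      exact le_antisymm h3 h4
  rw [h2] at hβ
  rcases h.eq_or_eq_neg hβ with h3 | h3
  · rwa [← h2] at h3
  · rw [← h2] at h3
    have := h0 s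
    rw [h3] at this
    simp [simpleRoot_apply_self] at this
    linarith

theorem reflection_eq_of_form_eq (B : RootPrebasis M) {w : M.Group} {s t : S}
    (hw : B.rep w (simpleRoot s) = simpleRoot t)
    (hf : ∀ r, B.form s (B.rep w⁻¹ (simpleRoot r)) = B.form t (simpleRoot r)) :
    B.rep (w * M.simple s * w⁻¹) = B.rep (M.simple t) := by
  have hf' : B.form s ∘ₗ (B.rep w⁻¹).toLinearMap = B.form t :=
    Finsupp.lhom_ext' fun r => LinearMap.ext_ring (hf r)
  ext1 x
  have hx := LinearMap.congr_fun hf' x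
  simp only [LinearMap.comp_apply, LinearEquiv.coe_coe] at hx
  rw [rep_mul_apply, rep_mul_apply, rep_simple, rep_simple, reflection_apply, reflection_apply,
    map_sub, map_smul, rep_apply_inv_apply, hw, hx]

/-- If `w (α_s) = α_t` then `w σ_s w⁻¹` and `σ_t` coincide. Both are reflections with root `α_t`,
so their product is a transvection `x ↦ x + f(x) α_t`; were `f(α_r) ≠ 0`, one of the roots
`α_r ± f(α_r) α_t` would have coordinates of both signs. -/
theorem IsReduced.rep_conj_eq (h : B.IsReduced) {w : M.Group} {s t : S}
    (hw : B.rep w (simpleRoot s) = simpleRoot t) :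
    B.rep (w * M.simple s * w⁻¹) = B.rep (M.simple t) := by
  have hw' : B.rep w⁻¹ (simpleRoot t) = simpleRoot s := by rw [← hw, rep_inv_apply_apply]
  have key : ∀ x, B.rep (w * M.simple s * w⁻¹) x =
      x - B.form s (B.rep w⁻¹ x) • simpleRoot t := by
    intro x
    rw [rep_mul_apply, rep_mul_apply, rep_simple, reflection_apply, map_sub, map_smul,
      rep_apply_inv_apply, hw]
  refine B.reflection_eq_of_form_eq hw fun r => ?_
  by_cases hr : r = t
  · subst hr
    rw [hw', B.form_self, B.form_self]
  set d := B.form s (B.rep w⁻¹ (simpleRoot r)) - B.form t (simpleRoot r) with hd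
  have e1 : B.rep (M.simple t * (w * M.simple s * w⁻¹)) (simpleRoot r) =
      simpleRoot r + d • simpleRoot t := by
    rw [rep_mul_apply, key, rep_simple, map_sub, map_smul, reflection_simpleRoot,
      reflection_apply, hd]
    module
  have e2 : B.rep ((w * M.simple s * w⁻¹) * M.simple t) (simpleRoot r) =
      simpleRoot r - d • simpleRoot t := by
    rw [rep_mul_apply, rep_simple, reflection_apply, key, map_sub, map_smul, map_sub, map_smul,
      hw', B.form_self, hd, smul_eq_mul]
    module
  have p1 : 0 ≤ simpleRoot r + d • simpleRoot t := by
    refine h.nonneg_of_pos (r := r) (e1 ▸ B.rep_simpleRoot_mem_roots _ r) ?_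
    simp [simpleRoot_apply_self, simpleRoot_apply_of_ne hr]
  have p2 : 0 ≤ simpleRoot r - d • simpleRoot t := by
    refine h.nonneg_of_pos (r := r) (e2 ▸ B.rep_simpleRoot_mem_roots _ r) ?_
    simp [simpleRoot_apply_self, simpleRoot_apply_of_ne hr]
  have q1 := p1 t
  have q2 := p2 t
  simp [simpleRoot_apply_self, simpleRoot_apply_of_ne (Ne.symm hr)] at q1 q2
  linarith

end RootPrebasis

/-! ### Length and positivity -/

section Alternating

variable {S W : Type*} [Group W] {M : CoxeterMatrix S} (cs : CoxeterSystem M W)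

theorem alternatingWord_eq_append (s t : S) {m k : ℕ} (h : m ≤ k) :
    ∃ p : List S, p.length = k - m ∧ alternatingWord s t k = p ++ alternatingWord s t m := by
  induction k, h using Nat.le_induction with
  | base => exact ⟨[], by simp, rfl⟩
  | succ k hk ih =>
    obtain ⟨p, hp, e⟩ := ih
    refine ⟨(if Even k then t else s) :: p, ?_, ?_⟩
    · rw [List.length_cons]; omega
    · rw [alternatingWord_succ', e, List.cons_append]

theorem wordProd_alternatingWord_succ (s t : S) (k : ℕ) :
    cs.wordProd (alternatingWord s t (k + 1)) =
      cs.simple (if Even k then t else s) * cs.wordProd (alternatingWord s t k) := by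
  rw [alternatingWord_succ', wordProd_cons]

/-- If `w` does not have the right descent `s` but has the right descent `t`, then it can be
written as `v` times an alternating word in `s` and `t` ending in `t`, with additive lengths, where
neither `s` nor `t` is a right descent of `v`, and the alternating word has less than `m_{s,t}`
letters. -/
theorem exists_alternating_factorization {w : W} {s t : S} (hs : ¬ cs.IsRightDescent w s)
    (ht : cs.IsRightDescent w t) :
    ∃ (v : W) (k : ℕ), w = v * cs.wordProd (alternatingWord s t k) ∧ cs.length v < cs.length w ∧
      ¬ cs.IsRightDescent v s ∧ ¬ cs.IsRightDescent v t ∧ (M s t ≠ 0 → k < M s t) := by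
  classical
  let P : ℕ → Prop := fun n => ∃ (v : W) (k : ℕ), cs.length v = n ∧
    w = v * cs.wordProd (alternatingWord s t (k + 1)) ∧ cs.length w = cs.length v + (k + 1)
  have hP : ∃ n, P n := by
    refine ⟨_, w * cs.simple t, 0, rfl, ?_, ?_⟩
    · simp [alternatingWord]
    · exact (cs.isRightDescent_iff.1 ht).symm
  obtain ⟨v, k, hn, hw, hl⟩ := Nat.find_spec hP
  have hmin := fun n (h : n < Nat.find hP) => Nat.find_min hP h
  have hnext : ¬ cs.IsRightDescent v (if Even (k + 1) then t else s) := by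
    intro hd
    rw [cs.isRightDescent_iff] at hd
    refine hmin _ (by omega) ⟨v * cs.simple (if Even (k + 1) then t else s), k + 1, rfl, ?_, ?_⟩
    · rw [wordProd_alternatingWord_succ cs s t (k + 1), ← mul_assoc,
        cs.simple_mul_simple_cancel_right, hw]
    · omega
  have hfirst : ¬ cs.IsRightDescent v (if Even k then t else s) := by
    intro hd
    rw [cs.isRightDescent_iff] at hd
    have h1 : w = v * cs.simple (if Even k then t else s) *
        cs.wordProd (alternatingWord s t k) := by
      rw [hw, wordProd_alternatingWord_succ, mul_assoc]
    have h2 := cs.length_mul_le (v * cs.simple (if Even k then t else s))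
      (cs.wordProd (alternatingWord s t k))
    rw [← h1] at h2
    have h3 := cs.length_wordProd_le (alternatingWord s t k)
    rw [length_alternatingWord] at h3
    omega
  refine ⟨v, k + 1, hw, by omega, ?_, ?_, ?_⟩
  · by_cases hk : Even k
    · simpa [Nat.even_add_one, hk] using hnext
    · simpa [hk] using hfirst
  · by_cases hk : Even k
    · simpa [hk] using hfirst
    · simpa [Nat.even_add_one, hk] using hnext
  · -- An alternating word with `m_{s,t}` letters could be rewritten so as to end in `s`.
    intro hm
    by_contra hk
    obtain ⟨p, hp, e⟩ := alternatingWord_eq_append s t (not_lt.1 hk)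
    obtain ⟨m, hm'⟩ := Nat.exists_eq_succ_of_ne_zero hm
    have h1 : cs.wordProd (alternatingWord s t (M s t)) =
        cs.wordProd (alternatingWord s t m) * cs.simple s := by
      rw [cs.prod_alternatingWord_eq_prod_alternatingWord_sub s t (M s t) (by omega),
        show M s t * 2 - M s t = m + 1 by omega, alternatingWord_succ, wordProd_concat]
    have h2 : w * cs.simple s = v * (cs.wordProd p * cs.wordProd (alternatingWord s t m)) := by
      rw [hw, e, wordProd_append, h1]
      simp only [mul_assoc, cs.simple_mul_simple_self, mul_one]
    have h3 := cs.length_mul_le v (cs.wordProd p * cs.wordProd (alternatingWord s t m))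
    have h4 := cs.length_mul_le (cs.wordProd p) (cs.wordProd (alternatingWord s t m))
    have h5 := cs.length_wordProd_le p
    have h6 := cs.length_wordProd_le (alternatingWord s t m)
    rw [length_alternatingWord] at h6
    rw [← h2] at h3
    apply hs
    rw [IsRightDescent]
    omega

end Alternating

namespace RootPrebasis

variable {S : Type*} {M : CoxeterMatrix S} {B : RootPrebasis M}

/-- In the dihedral group generated by `s ≠ t`, an alternating word ending in `t` with less than
`m_{s,t}` letters maps `α_s` to a positive root. -/
theorem IsReduced.alternatingWord_nonneg (h : B.IsReduced) (s t : S) :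
    ∀ k : ℕ, (M s t ≠ 0 → k < M s t) →
      0 ≤ B.rep (M.toCoxeterSystem.wordProd (alternatingWord s t k)) (simpleRoot s) := by
  intro k
  induction k with
  | zero => intro _; simpa [alternatingWord] using simpleRoot_nonneg s
  | succ k ih =>
    intro hk
    set cs := M.toCoxeterSystem with hcs
    have h0 := ih fun hm => lt_of_le_of_lt (Nat.le_succ k) (hk hm)
    by_contra hneg
    set x := cs.wordProd (alternatingWord s t k) with hx
    rw [wordProd_alternatingWord_succ, rep_mul_apply,
      show cs.simple (if Even k then t else s) = M.simple (if Even k then t else s) from rfl,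
      rep_simple] at hneg
    have e := h.eq_simpleRoot_of_reflection_not_nonneg (B.rep_simpleRoot_mem_roots _ _) h0 hneg
    have e2 := h.rep_conj_eq e
    -- the two alternating words of lengths `k` and `k + 2` have the same image
    have e3 : B.rep (cs.wordProd (alternatingWord t s (k + 2))) = B.rep x := by
      rw [alternatingWord_succ, wordProd_concat, wordProd_alternatingWord_succ, map_mul, map_mul,
        ← hx]
      change B.rep (M.simple _) * _ * B.rep (M.simple s) = _
      rw [← e2, ← map_mul, ← map_mul]
      congr 1
      rw [inv_mul_cancel_right, mul_assoc]
      have := cs.simple_mul_simple_self s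
      change M.simple s * M.simple s = 1 at this
      rw [this, mul_one]
    have hpow : (B.rep (cs.simple t * cs.simple s)) ^ (k + 1) = 1 := by
      have hinv : (B.rep (cs.simple t * cs.simple s))⁻¹ = B.rep (cs.simple s * cs.simple t) := by
        rw [← map_inv, mul_inv_rev, cs.inv_simple, cs.inv_simple]
      rw [hx, cs.prod_alternatingWord_eq_mul_pow, cs.prod_alternatingWord_eq_mul_pow,
        map_mul, map_mul, map_pow, map_pow, ← hinv, Nat.add_div_right _ two_pos,
        inv_pow] at e3
      by_cases hev : Even k
      · simp only [Nat.even_add, hev, even_two, if_true, map_one, one_mul, iff_self] at e3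
        obtain ⟨j, rfl⟩ := hev
        rw [eq_inv_iff_mul_eq_one, ← pow_add] at e3
        convert e3 using 2
        omega
      · simp only [Nat.even_add, hev, even_two, if_false, iff_true] at e3
        have e4 := congrArg (fun y => B.rep (cs.simple t) * y) e3
        simp only [← mul_assoc, ← map_mul, cs.simple_mul_simple_self, map_one, one_mul] at e4
        rw [eq_inv_iff_mul_eq_one, ← pow_succ', ← pow_add] at e4
        obtain ⟨j, rfl⟩ := Nat.not_even_iff_odd.1 hev
        convert e4 using 2
        omega
    have hord : orderOf (B.rep (cs.simple t * cs.simple s)) = M s t := by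
      rw [M.symmetric, ← B.orderOf_mul t s, map_mul]
      change orderOf (B.rep (M.simple t) * B.rep (M.simple s)) = _
      rw [rep_simple, rep_simple]; rfl
    have hdvd := orderOf_dvd_of_pow_eq_one hpow
    rw [hord] at hdvd
    by_cases hm : M s t = 0
    · rw [hm] at hdvd
      simp at hdvd
    · exact absurd (Nat.le_of_dvd (Nat.succ_pos k) hdvd) (not_le.2 (hk hm))

/-- `W_X` acts trivially on `V / V_X`, where `V_X` is spanned by the `α_s` with `s ∈ X`. -/
theorem rep_apply_of_notMem (B : RootPrebasis M) {X : Set S} {w : M.Group}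
    (hw : w ∈ standardParabolic M X) (x : S →₀ ℝ) {r : S} (hr : r ∉ X) :
    B.rep w x r = x r := by
  induction hw using Subgroup.closure_induction generalizing x with
  | mem w hw =>
    obtain ⟨s, hs, rfl⟩ := hw
    rw [rep_simple, reflection_apply]
    have : r ≠ s := fun e => hr (e ▸ hs)
    simp [simpleRoot_apply_of_ne this]
  | one => rw [map_one]; rfl
  | mul a b _ _ iha ihb => rw [rep_mul_apply, iha, ihb]
  | inv a _ iha => rw [← iha, rep_apply_inv_apply]

theorem wordProd_alternatingWord_mem_standardParabolic (s t : S) (k : ℕ) :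
    M.toCoxeterSystem.wordProd (alternatingWord s t k) ∈ standardParabolic M {s, t} := by
  induction k with
  | zero => simp [alternatingWord, one_mem]
  | succ k ih =>
    rw [wordProd_alternatingWord_succ]
    refine mul_mem (Subgroup.subset_closure ⟨_, ?_, rfl⟩) ih
    split_ifs <;> simp

theorem eq_add_of_apply_eq_zero {x : S →₀ ℝ} {s t : S} (hst : s ≠ t)
    (hx : ∀ r, r ≠ s → r ≠ t → x r = 0) : x = x s • simpleRoot s + x t • simpleRoot t := by
  ext r
  by_cases h1 : r = s
  · subst h1; simp [simpleRoot_apply_self, simpleRoot_apply_of_ne hst]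
  by_cases h2 : r = t
  · subst h2; simp [simpleRoot_apply_self, simpleRoot_apply_of_ne hst.symm]
  simp [simpleRoot_apply_of_ne h1, simpleRoot_apply_of_ne h2, hx r h1 h2]

/-- The fundamental link between length and positivity: if `s` does not shorten `w` on the right,
then `w (α_s)` is a positive root. It is stated for the Coxeter group `W'` of a full subgraph,
acting through a homomorphism `f` to the Coxeter group of `M`, so as to show that `f` is
injective. -/
theorem IsReduced.rep_map_nonneg (h : B.IsReduced) {S' W' : Type*} [Group W']
    {M' : CoxeterMatrix S'} (cs : CoxeterSystem M' W') {j : S' → S} (hj : Function.Injective j)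
    (hM : ∀ s t, M' s t = M (j s) (j t)) {f : W' →* M.Group}
    (hf : ∀ s, f (cs.simple s) = M.simple (j s)) :
    ∀ {w : W'} {s : S'}, ¬ cs.IsRightDescent w s → 0 ≤ B.rep (f w) (simpleRoot (j s)) := by
  have hword : ∀ (s t : S') (k : ℕ), f (cs.wordProd (alternatingWord s t k)) =
      M.toCoxeterSystem.wordProd (alternatingWord (j s) (j t) k) := by
    intro s t k
    induction k with
    | zero => simp [alternatingWord]
    | succ k ih =>
      rw [wordProd_alternatingWord_succ, wordProd_alternatingWord_succ, map_mul, hf, ih]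
      split_ifs <;> rfl
  intro w
  induction hn : cs.length w using Nat.strong_induction_on generalizing w with
  | _ n ih =>
  intro s hs
  by_cases hw1 : w = 1
  · subst hw1
    rw [map_one, map_one]
    exact simpleRoot_nonneg _
  obtain ⟨t, ht⟩ := cs.exists_rightDescent_of_ne_one hw1
  have hst : s ≠ t := fun e => hs (e ▸ ht)
  obtain ⟨v, k, rfl, hlt, hvs, hvt, hk⟩ := exists_alternating_factorization cs hs ht
  rw [map_mul, rep_mul_apply, hword]
  set x := M.toCoxeterSystem.wordProd (alternatingWord (j s) (j t) k) with hx
  have hpos : 0 ≤ B.rep x (simpleRoot (j s)) :=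
    h.alternatingWord_nonneg (j s) (j t) k (by rw [← hM]; exact hk)
  have hxmem : x ∈ standardParabolic M {j s, j t} :=
    wordProd_alternatingWord_mem_standardParabolic (j s) (j t) k
  have e : B.rep x (simpleRoot (j s)) = B.rep x (simpleRoot (j s)) (j s) • simpleRoot (j s) +
      B.rep x (simpleRoot (j s)) (j t) • simpleRoot (j t) := by
    refine eq_add_of_apply_eq_zero (hj.ne hst) fun r h1 h2 => ?_
    rw [B.rep_apply_of_notMem hxmem _ (by simp [h1, h2]), simpleRoot_apply_of_ne h1]
  rw [e, map_add, map_smul, map_smul]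
  exact add_nonneg (smul_nonneg (hpos _) (ih _ (hn ▸ hlt) rfl hvs))
    (smul_nonneg (hpos _) (ih _ (hn ▸ hlt) rfl hvt))

theorem IsReduced.rep_map_nonpos (h : B.IsReduced) {S' W' : Type*} [Group W']
    {M' : CoxeterMatrix S'} (cs : CoxeterSystem M' W') {j : S' → S} (hj : Function.Injective j)
    (hM : ∀ s t, M' s t = M (j s) (j t)) {f : W' →* M.Group}
    (hf : ∀ s, f (cs.simple s) = M.simple (j s)) {w : W'} {s : S'} (hs : cs.IsRightDescent w s) :
    B.rep (f w) (simpleRoot (j s)) ≤ 0 := by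
  have h1 := h.rep_map_nonneg cs hj hM hf (cs.isRightDescent_iff_not_isRightDescent_mul.1 hs)
  rw [map_mul, hf, rep_mul_apply, rep_simple, reflection_simpleRoot, map_neg] at h1
  exact neg_nonneg.1 h1

/-- The representation is faithful on the Coxeter group of a full subgraph. -/
theorem IsReduced.map_injective (h : B.IsReduced) {S' W' : Type*} [Group W']
    {M' : CoxeterMatrix S'} (cs : CoxeterSystem M' W') {j : S' → S} (hj : Function.Injective j)
    (hM : ∀ s t, M' s t = M (j s) (j t)) {f : W' →* M.Group}
    (hf : ∀ s, f (cs.simple s) = M.simple (j s)) : Function.Injective (fun w => B.rep (f w)) := by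
  refine (injective_iff_map_eq_one (B.rep.comp f)).2 fun w hw => ?_
  by_contra hw1
  obtain ⟨s, hs⟩ := cs.exists_rightDescent_of_ne_one hw1
  have h1 := h.rep_map_nonpos cs hj hM hf hs
  rw [show B.rep (f w) = 1 from hw] at h1
  exact not_nonpos_of_nonneg (B.simpleRoot_mem_roots _) (simpleRoot_nonneg (j s)) h1

theorem IsReduced.isRightDescent_iff (h : B.IsReduced) {w : M.Group} {s : S} :
    M.toCoxeterSystem.IsRightDescent w s ↔ B.rep w (simpleRoot s) ≤ 0 := by
  constructor
  · intro hs
    exact h.rep_map_nonpos M.toCoxeterSystem (j := id) Function.injective_id (fun _ _ => rfl)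
      (f := MonoidHom.id _) (fun _ => rfl) hs
  · intro hs
    by_contra hn
    exact not_nonpos_of_nonneg (B.rep_simpleRoot_mem_roots w s)
      (h.rep_map_nonneg M.toCoxeterSystem (j := id) Function.injective_id (fun _ _ => rfl)
      (f := MonoidHom.id _) (fun _ => rfl) hn) hs

theorem IsReduced.isLeftDescent_iff (h : B.IsReduced) {w : M.Group} {s : S} :
    M.toCoxeterSystem.IsLeftDescent w s ↔ B.rep w⁻¹ (simpleRoot s) ≤ 0 := by
  rw [← h.isRightDescent_iff, isRightDescent_inv_iff]

theorem IsReduced.rep_injective (h : B.IsReduced) : Function.Injective B.rep :=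
  h.map_injective M.toCoxeterSystem (j := id) Function.injective_id (fun _ _ => rfl)
    (f := MonoidHom.id _) (fun _ => rfl)

end RootPrebasis

/-! ### Parabolic subgroups and reflections -/

namespace RootPrebasis

variable {S : Type*} {M : CoxeterMatrix S} {B : RootPrebasis M}

theorem simple_mul_self (s : S) : M.simple s * M.simple s = 1 :=
  M.toCoxeterSystem.simple_mul_simple_self s

theorem inv_simple (s : S) : (M.simple s)⁻¹ = M.simple s :=
  M.toCoxeterSystem.inv_simple s

theorem simple_mem_standardParabolic {X : Set S} {s : S} (hs : s ∈ X) :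
    M.simple s ∈ standardParabolic M X :=
  Subgroup.subset_closure ⟨s, hs, rfl⟩

/-- An element of the Coxeter group that acts trivially on `V / V_X`, where `V_X` is spanned by the
`α_s` with `s ∈ X`, has all its right descents in `X`. -/
theorem IsReduced.mem_of_isRightDescent (h : B.IsReduced) {X : Set S} {w : M.Group}
    (hw : ∀ x : S →₀ ℝ, ∀ r ∉ X, B.rep w x r = x r) {s : S}
    (hs : M.toCoxeterSystem.IsRightDescent w s) : s ∈ X := by
  by_contra hsX
  have h1 := h.isRightDescent_iff.1 hs s
  rw [hw _ s hsX, simpleRoot_apply_self] at h1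
  exact absurd h1 (by simp)

/-- `W_X` is the subgroup of the elements acting trivially on `V / V_X`. Conversely to
`rep_apply_of_notMem`, if `w` acts trivially, an element of minimal length of `w W_X` has no right
descent, neither in `X` nor outside `X`. -/
theorem IsReduced.mem_standardParabolic (h : B.IsReduced) {X : Set S} {w : M.Group}
    (hw : ∀ x : S →₀ ℝ, ∀ r ∉ X, B.rep w x r = x r) : w ∈ standardParabolic M X := by
  classical
  have hP : ∃ n, ∃ u ∈ standardParabolic M X, M.toCoxeterSystem.length (w * u) = n :=
    ⟨_, 1, one_mem _, rfl⟩
  obtain ⟨u, hu, hn⟩ := Nat.find_spec hP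
  have hmin := fun n (hn : n < Nat.find hP) => Nat.find_min hP hn
  by_cases h1 : w * u = 1
  · rw [eq_inv_of_mul_eq_one_left h1]
    exact inv_mem hu
  obtain ⟨s, hs⟩ := M.toCoxeterSystem.exists_rightDescent_of_ne_one h1
  have hsX : s ∈ X := h.mem_of_isRightDescent (fun x r hr => by
    rw [rep_mul_apply, hw _ r hr, B.rep_apply_of_notMem hu x hr]) hs
  refine absurd ⟨u * M.simple s, mul_mem hu (simple_mem_standardParabolic hsX), rfl⟩
    (hmin _ ?_)
  rw [← hn, ← mul_assoc]
  exact hs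

theorem IsReduced.eq_one_of_forall_not_isRightDescent (h : B.IsReduced) {X : Set S} {w : M.Group}
    (hw : w ∈ standardParabolic M X) (hX : ∀ s ∈ X, ¬ M.toCoxeterSystem.IsRightDescent w s) :
    w = 1 := by
  by_contra h1
  obtain ⟨s, hs⟩ := M.toCoxeterSystem.exists_rightDescent_of_ne_one h1
  exact hX s (h.mem_of_isRightDescent (fun x r hr => B.rep_apply_of_notMem hw x hr) hs) hs

/-- When an element of `W_X` makes a positive root negative, the sign changes at some step along a
word in `X`, where the root has become a simple root. -/
theorem IsReduced.exists_eq_rep_of_not_nonneg (h : B.IsReduced) {X : Set S} {u : M.Group}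
    (hu : u ∈ standardParabolic M X) : ∀ {β : S →₀ ℝ}, β ∈ B.roots → 0 ≤ β → ¬ 0 ≤ B.rep u β →
      ∃ x ∈ standardParabolic M X, ∃ s ∈ X, β = B.rep x (simpleRoot s) := by
  induction hu using Subgroup.closure_induction with
  | mem w hw =>
    obtain ⟨s, hs, rfl⟩ := hw
    intro β hβ h0 hn
    rw [rep_simple] at hn
    exact ⟨1, one_mem _, s, hs, by
      rw [map_one]; exact h.eq_simpleRoot_of_reflection_not_nonneg hβ h0 hn⟩
  | one => intro β _ h0 hn; rw [map_one] at hn; exact absurd h0 hn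
  | mul a b _ hb iha ihb =>
    intro β hβ h0 hn
    by_cases hb0 : 0 ≤ B.rep b β
    · rw [rep_mul_apply] at hn
      obtain ⟨x, hx, s, hs, e⟩ := iha (rep_mem_roots _ hβ) hb0 hn
      exact ⟨b⁻¹ * x, mul_mem (inv_mem hb) hx, s, hs, by
        rw [rep_mul_apply, ← e, rep_inv_apply_apply]⟩
    · exact ihb hβ h0 hb0
  | inv a ha iha =>
    intro β hβ h0 hn
    have hβ' := rep_mem_roots a⁻¹ hβ
    have h1 := (h.nonneg_or_nonpos hβ').resolve_left hn
    obtain ⟨w, t, e⟩ := hβ'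
    have e' : -B.rep a⁻¹ β = B.rep (w * M.simple t) (simpleRoot t) := by
      rw [rep_mul_apply, rep_simple, reflection_simpleRoot, map_neg, e]
    have h2 : ¬ 0 ≤ B.rep a (-B.rep a⁻¹ β) := by
      rw [map_neg, rep_apply_inv_apply]
      exact fun h3 => not_nonpos_of_nonneg hβ h0 (neg_nonneg.1 h3)
    obtain ⟨x, hx, s, hs, e2⟩ := iha (e' ▸ B.rep_simpleRoot_mem_roots _ _) (neg_nonneg.2 h1) h2
    refine ⟨a * x * M.simple s, mul_mem (mul_mem ha hx) (simple_mem_standardParabolic hs),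
      s, hs, ?_⟩
    rw [rep_mul_apply, rep_mul_apply, rep_simple, reflection_simpleRoot, map_neg, ← e2, neg_neg,
      rep_apply_inv_apply]

/-- A positive root supported in `X` is a root of the parabolic subgroup `W_X`: the corresponding
reflection belongs to `W_X` and makes the root negative. -/
theorem IsReduced.exists_eq_rep_of_support (h : B.IsReduced) {X : Set S} {β : S →₀ ℝ}
    (hβ : β ∈ B.roots) (h0 : 0 ≤ β) (hX : ∀ r ∉ X, β r = 0) :
    ∃ x ∈ standardParabolic M X, ∃ s ∈ X, β = B.rep x (simpleRoot s) := by
  obtain ⟨w, a, rfl⟩ := hβ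
  have hr : ∀ x, B.rep (w * M.simple a * w⁻¹) x =
      x - B.form a (B.rep w⁻¹ x) • B.rep w (simpleRoot a) := fun x => by
    rw [rep_mul_apply, rep_mul_apply, rep_simple, reflection_apply, map_sub, map_smul,
      rep_apply_inv_apply]
  refine h.exists_eq_rep_of_not_nonneg (u := w * M.simple a * w⁻¹)
    (h.mem_standardParabolic fun x r hrX => ?_) (B.rep_simpleRoot_mem_roots w a) h0 ?_
  · rw [hr, Finsupp.sub_apply, Finsupp.smul_apply, hX r hrX, smul_zero, sub_zero]
  · rw [rep_mul_apply, rep_inv_apply_apply, rep_mul_apply, rep_simple, reflection_simpleRoot,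
      map_neg, neg_nonneg]
    exact not_nonpos_of_nonneg (B.rep_simpleRoot_mem_roots w a) h0

/-- The reflections of the Coxeter group correspond to the pairs of opposite roots. -/
theorem IsReduced.conj_eq_conj_iff (h : B.IsReduced) {v w : M.Group} {s t : S} :
    v * M.simple s * v⁻¹ = w * M.simple t * w⁻¹ ↔
      B.rep v (simpleRoot s) = B.rep w (simpleRoot t) ∨
        B.rep v (simpleRoot s) = -B.rep w (simpleRoot t) := by
  have key : ∀ u : M.Group, u * M.simple s * u⁻¹ = M.simple t ↔
      B.rep u (simpleRoot s) = simpleRoot t ∨ B.rep u (simpleRoot s) = -simpleRoot t := by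
    intro u
    constructor
    · intro e
      have e1 : B.reflection t (B.rep u (simpleRoot s)) = -B.rep u (simpleRoot s) := by
        rw [← rep_simple, ← e, rep_mul_apply, rep_inv_apply_apply, rep_mul_apply, rep_simple,
          reflection_simpleRoot, map_neg]
      rw [reflection_apply] at e1
      have e2 : B.rep u (simpleRoot s) =
          ((1 / 2 : ℝ) * B.form t (B.rep u (simpleRoot s))) • simpleRoot t := by
        have e3 : B.form t (B.rep u (simpleRoot s)) • simpleRoot t =
            (2 : ℝ) • B.rep u (simpleRoot s) := by
          rw [two_smul, ← sub_eq_iff_eq_add', ← neg_sub, e1, neg_neg]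
        rw [mul_smul, e3, smul_smul]
        norm_num
      have e4 := h.eq_or_eq_neg (e2 ▸ B.rep_simpleRoot_mem_roots u s)
      rwa [← e2] at e4
    · rintro (e | e)
      · exact h.rep_injective (h.rep_conj_eq e)
      · have e1 : B.rep (u * M.simple s) (simpleRoot s) = simpleRoot t := by
          rw [rep_mul_apply, rep_simple, reflection_simpleRoot, map_neg, e, neg_neg]
        have e2 := h.rep_injective (h.rep_conj_eq e1)
        rwa [mul_assoc u, simple_mul_self, mul_one, mul_inv_rev, inv_simple, ← mul_assoc] at e2
  have e := key (w⁻¹ * v)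
  rw [rep_mul_apply] at e
  rw [← (B.rep w⁻¹).injective.eq_iff, ← (B.rep w⁻¹).injective.eq_iff (b := -_), map_neg,
    rep_inv_apply_apply, ← e]
  rw [mul_inv_rev, inv_inv, ← mul_right_inj w⁻¹, ← mul_left_inj w]
  simp only [mul_assoc, inv_mul_cancel, mul_one, inv_mul_cancel_left]

/-! ### Longest elements -/

theorem map_nonneg_of_support (f : (S →₀ ℝ) →ₗ[ℝ] (S →₀ ℝ)) {X : Set S}
    (hf : ∀ s ∈ X, 0 ≤ f (simpleRoot s)) {x : S →₀ ℝ} (h0 : 0 ≤ x) (hX : ∀ r ∉ X, x r = 0) :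
    0 ≤ f x := by
  rw [← Finsupp.sum_single x, Finsupp.sum, map_sum]
  refine Finset.sum_nonneg fun s hs => ?_
  have hsX : s ∈ X := by
    by_contra hn
    exact Finsupp.mem_support_iff.1 hs (hX s hn)
  rw [← Finsupp.smul_single_one, map_smul]
  exact smul_nonneg (h0 s) (hf s hsX)

theorem rep_simpleRoot_apply_of_notMem (B : RootPrebasis M) {X : Set S} {w : M.Group}
    (hw : w ∈ standardParabolic M X) {s : S} (hs : s ∈ X) {r : S} (hr : r ∉ X) :
    B.rep w (simpleRoot s) r = 0 := by
  rw [B.rep_apply_of_notMem hw _ hr, simpleRoot_apply_of_ne]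
  rintro rfl
  exact hr hs

theorem IsReduced.rep_inv_nonpos_of_isLongestElement (h : B.IsReduced) {X : Set S} {u : M.Group}
    (hu : IsLongestElement M X u) {s : S} (hs : s ∈ X) : B.rep u⁻¹ (simpleRoot s) ≤ 0 :=
  h.isLeftDescent_iff.1 (hu.2 s hs)

/-- The inverse of a longest element of `W_X` makes all positive vectors supported in `X`
negative. -/
theorem IsReduced.rep_inv_nonpos_of_support (h : B.IsReduced) {X : Set S} {u : M.Group}
    (hu : IsLongestElement M X u) {x : S →₀ ℝ} (h0 : 0 ≤ x) (hX : ∀ r ∉ X, x r = 0) :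
    B.rep u⁻¹ x ≤ 0 := by
  have := map_nonneg_of_support (-(B.rep u⁻¹).toLinearMap) (X := X)
    (fun s hs => neg_nonneg.2 (h.rep_inv_nonpos_of_isLongestElement hu hs)) h0 hX
  exact neg_nonneg.1 this

theorem IsReduced.rep_nonpos_of_isLongestElement (h : B.IsReduced) {X : Set S} {u : M.Group}
    (hu : IsLongestElement M X u) {s : S} (hs : s ∈ X) : B.rep u (simpleRoot s) ≤ 0 := by
  refine (h.nonneg_or_nonpos (B.rep_simpleRoot_mem_roots u s)).resolve_left fun h0 => ?_
  have h1 := h.rep_inv_nonpos_of_support hu h0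
    (fun r hr => B.rep_simpleRoot_apply_of_notMem hu.1 hs hr)
  rw [rep_inv_apply_apply] at h1
  exact not_nonpos_of_nonneg (B.simpleRoot_mem_roots s) (simpleRoot_nonneg s) h1

theorem IsReduced.isLongestElement_unique (h : B.IsReduced) {X : Set S} {u v : M.Group}
    (hu : IsLongestElement M X u) (hv : IsLongestElement M X v) : u = v := by
  have h1 : u⁻¹ * v = 1 := by
    refine h.eq_one_of_forall_not_isRightDescent (mul_mem (inv_mem hu.1) hv.1) fun s hs hd => ?_
    have h2 := h.isRightDescent_iff.1 hd
    refine not_nonpos_of_nonneg (B.rep_simpleRoot_mem_roots _ s) ?_ h2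
    rw [rep_mul_apply]
    have h3 := h.rep_inv_nonpos_of_support hu
      (neg_nonneg.2 (h.rep_nonpos_of_isLongestElement hv hs))
      (fun r hr => by
        rw [Finsupp.neg_apply, B.rep_simpleRoot_apply_of_notMem hv.1 hs hr, neg_zero])
    rw [map_neg] at h3
    exact neg_nonpos.1 h3
  exact (inv_mul_eq_one.1 h1)

/-- If all elements of `X` are left descents of `w`, then `W_X` has a longest element `u`, and
`u⁻¹ w` is shorter than `w`: write `w = u v` with `v` of minimal length in the coset `W_X w`; then
`v⁻¹` keeps the positive vectors of `V_X` positive, so that `u⁻¹ (α_s)` is negative together with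
`w⁻¹ (α_s)` for `s ∈ X`. -/
theorem IsReduced.exists_isLongestElement_of_descents (h : B.IsReduced) {X : Set S}
    (hne : X.Nonempty) {w : M.Group} (hw : ∀ s ∈ X, M.toCoxeterSystem.IsLeftDescent w s) :
    ∃ u, IsLongestElement M X u ∧
      M.toCoxeterSystem.length (u⁻¹ * w) < M.toCoxeterSystem.length w := by
  classical
  have hP : ∃ n, ∃ u ∈ standardParabolic M X, M.toCoxeterSystem.length (u⁻¹ * w) = n :=
    ⟨_, 1, one_mem _, rfl⟩
  obtain ⟨u, hu, hn⟩ := Nat.find_spec hP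
  have hmin := fun u' (hu' : u' ∈ standardParabolic M X) =>
    hn.le.trans (Nat.find_min' hP ⟨u', hu', rfl⟩)
  have hv : ∀ r ∈ X, 0 ≤ B.rep (u⁻¹ * w)⁻¹ (simpleRoot r) := by
    intro r hr
    refine (h.nonneg_or_nonpos (B.rep_simpleRoot_mem_roots _ r)).resolve_right fun hneg => ?_
    have h1 : M.toCoxeterSystem.IsLeftDescent (u⁻¹ * w) r := h.isLeftDescent_iff.2 hneg
    have h2 := hmin (u * M.simple r) (mul_mem hu (simple_mem_standardParabolic hr))
    rw [mul_inv_rev, inv_simple, mul_assoc] at h2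
    exact absurd h1 (not_lt.2 h2)
  refine ⟨u, ⟨hu, fun s hs => h.isLeftDescent_iff.2 ?_⟩, ?_⟩
  · refine (h.nonneg_or_nonpos (B.rep_simpleRoot_mem_roots _ s)).resolve_left fun h0 => ?_
    have h1 := map_nonneg_of_support (B.rep (u⁻¹ * w)⁻¹).toLinearMap hv h0
      (fun r hr => B.rep_simpleRoot_apply_of_notMem (inv_mem hu) hs hr)
    rw [LinearEquiv.coe_coe, mul_inv_rev, inv_inv, ← rep_mul_apply, mul_assoc, mul_inv_cancel,
      mul_one] at h1
    exact not_nonpos_of_nonneg (B.rep_simpleRoot_mem_roots _ s) h1 (h.isLeftDescent_iff.1 (hw s hs))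
  · obtain ⟨s, hs⟩ := hne
    refine lt_of_le_of_lt (hmin (M.simple s) (simple_mem_standardParabolic hs)) ?_
    rw [inv_simple]
    exact hw s hs

theorem IsReduced.length_add_length_of_isLongestElement (h : B.IsReduced) {X : Set S}
    {u : M.Group} (hu : IsLongestElement M X u) :
    ∀ {x : M.Group}, x ∈ standardParabolic M X →
      M.toCoxeterSystem.length x + M.toCoxeterSystem.length (x⁻¹ * u) =
        M.toCoxeterSystem.length u := by
  intro x
  induction hn : M.toCoxeterSystem.length x using Nat.strong_induction_on generalizing x with
  | _ n ih =>
  intro hx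
  by_cases h1 : x = 1
  · subst h1
    rw [M.toCoxeterSystem.length_one] at hn
    rw [← hn, inv_one, one_mul, zero_add]
  obtain ⟨s, hs⟩ := M.toCoxeterSystem.exists_rightDescent_of_ne_one h1
  have hsX : s ∈ X := h.mem_of_isRightDescent (fun y r hr => B.rep_apply_of_notMem hx y hr) hs
  have hl := M.toCoxeterSystem.isRightDescent_iff.1 hs
  change M.toCoxeterSystem.length (x * M.simple s) + 1 = _ at hl
  have hx' : x * M.simple s ∈ standardParabolic M X :=
    mul_mem hx (simple_mem_standardParabolic hsX)
  have e := ih _ (by omega) rfl hx'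
  have h0 : 0 ≤ B.rep (x * M.simple s) (simpleRoot s) := by
    rw [rep_mul_apply, rep_simple, reflection_simpleRoot, map_neg]
    exact neg_nonneg.2 (h.isRightDescent_iff.1 hs)
  have h2 : M.toCoxeterSystem.IsLeftDescent ((x * M.simple s)⁻¹ * u) s := by
    rw [h.isLeftDescent_iff, mul_inv_rev, inv_inv, rep_mul_apply]
    exact h.rep_inv_nonpos_of_support hu h0
      (fun r hr => B.rep_simpleRoot_apply_of_notMem hx' hsX hr)
  have h3 := M.toCoxeterSystem.isLeftDescent_iff.1 h2
  change M.toCoxeterSystem.length (M.simple s * _) + 1 = _ at h3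
  rw [mul_inv_rev, ← mul_assoc, mul_inv_cancel_left] at h3
  rw [mul_inv_rev] at e
  omega

/-- A parabolic subgroup with a longest element, over a finite set, is finite, as the length is
bounded on it. -/
theorem IsReduced.finite_standardParabolic (h : B.IsReduced) {X : Set S} (hX : X.Finite)
    {u : M.Group} (hu : IsLongestElement M X u) :
    ((standardParabolic M X : Subgroup M.Group) : Set M.Group).Finite := by
  have hfin : ∀ n, {x | x ∈ standardParabolic M X ∧ M.toCoxeterSystem.length x ≤ n}.Finite := by
    intro n
    induction n with
    | zero =>
      refine (Set.finite_singleton 1).subset fun x hx => ?_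
      exact M.toCoxeterSystem.length_eq_zero_iff.1 (Nat.le_zero.1 hx.2)
    | succ n ih =>
      refine ((Set.finite_singleton 1).union
        (Set.Finite.image2 (fun x s => x * M.simple s) ih hX)).subset fun x hx => ?_
      by_cases h1 : x = 1
      · exact Or.inl h1
      right
      obtain ⟨s, hs⟩ := M.toCoxeterSystem.exists_rightDescent_of_ne_one h1
      have hsX : s ∈ X :=
        h.mem_of_isRightDescent (fun y r hr => B.rep_apply_of_notMem hx.1 y hr) hs
      refine ⟨x * M.simple s, ⟨mul_mem hx.1 (simple_mem_standardParabolic hsX), ?_⟩, s, hsX, ?_⟩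
      · exact Nat.le_of_lt_succ (lt_of_lt_of_le hs hx.2)
      · exact M.toCoxeterSystem.simple_mul_simple_cancel_right s
  refine (hfin (M.toCoxeterSystem.length u)).subset fun x hx => ⟨hx, ?_⟩
  have := h.length_add_length_of_isLongestElement hu hx
  omega

theorem exists_isLongestElement_of_finite {X : Set S}
    (hX : ((standardParabolic M X : Subgroup M.Group) : Set M.Group).Finite) :
    ∃ u, IsLongestElement M X u := by
  obtain ⟨u, hu, hmax⟩ := Set.exists_max_image _ M.toCoxeterSystem.length hX ⟨1, one_mem _⟩
  refine ⟨u, hu, fun s hs => lt_of_le_of_ne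
    (hmax _ (mul_mem (simple_mem_standardParabolic hs) hu))
    (M.toCoxeterSystem.length_simple_mul_ne u s)⟩

/-- The opposite of the longest element `u` of `W_X` permutes the simple roots `α_s`, `s ∈ X`. -/
theorem IsReduced.exists_rep_eq_neg (h : B.IsReduced) {X : Set S} {u : M.Group}
    (hu : IsLongestElement M X u) {s : S} (hs : s ∈ X) :
    ∃ t ∈ X, B.rep u (simpleRoot t) = -simpleRoot s := by
  have h1 := h.length_add_length_of_isLongestElement hu
    (mul_mem (simple_mem_standardParabolic hs) hu.1)
  have h2 := M.toCoxeterSystem.isLeftDescent_iff.1 (hu.2 s hs)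
  change M.toCoxeterSystem.length (M.simple s * u) + 1 = _ at h2
  obtain ⟨t, ht⟩ := M.toCoxeterSystem.length_eq_one_iff.1
    (show M.toCoxeterSystem.length ((M.simple s * u)⁻¹ * u) = 1 by omega)
  change _ = M.simple t at ht
  have ht' : M.simple t ∈ standardParabolic M X := by
    rw [← ht]
    exact mul_mem (inv_mem (mul_mem (simple_mem_standardParabolic hs) hu.1)) hu.1
  have htX : t ∈ X := by
    refine h.mem_of_isRightDescent (fun y r hr => B.rep_apply_of_notMem ht' y hr) ?_
    rw [h.isRightDescent_iff, rep_simple, reflection_simpleRoot]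
    exact neg_nonpos.2 (simpleRoot_nonneg t)
  refine ⟨t, htX, ?_⟩
  have e : u * M.simple t * u⁻¹ = 1 * M.simple s * 1⁻¹ := by
    rw [← ht, mul_inv_rev, inv_simple]; group
  have e2 := h.conj_eq_conj_iff.1 e
  rw [map_one] at e2
  refine e2.resolve_left fun e3 => ?_
  have h4 := h.rep_nonpos_of_isLongestElement hu htX
  rw [e3] at h4
  exact not_nonpos_of_nonneg (B.simpleRoot_mem_roots s) (simpleRoot_nonneg s) h4

end RootPrebasis

/-! ### The fixed subgroup -/

section Fixed

variable {S : Type*} {M : CoxeterMatrix S} {G : Subgroup (symmetryGroup M)}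

theorem groupAction_mul (g k : symmetryGroup M) (w : M.Group) :
    groupAction (g * k) w = groupAction g (groupAction k w) := by
  have : groupAction (g * k) = (groupAction g).comp (groupAction k) :=
    M.toCoxeterSystem.ext_simple fun s => by
      change groupAction (g * k) (M.simple s) = groupAction g (groupAction k (M.simple s))
      simp [groupAction_simple]
  rw [this]; rfl

theorem groupAction_one (w : M.Group) : groupAction 1 w = w := by
  have : groupAction (1 : symmetryGroup M) = MonoidHom.id _ :=
    M.toCoxeterSystem.ext_simple fun s => by
      change groupAction 1 (M.simple s) = M.simple s
      simp [groupAction_simple]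
  rw [this]; rfl

theorem length_groupAction_le (g : symmetryGroup M) (w : M.Group) :
    M.toCoxeterSystem.length (groupAction g w) ≤ M.toCoxeterSystem.length w := by
  obtain ⟨ω, hω, rfl⟩ := M.toCoxeterSystem.exists_isReduced w
  have : groupAction g (M.toCoxeterSystem.wordProd ω) =
      M.toCoxeterSystem.wordProd (ω.map (g : Equiv.Perm S)) := by
    clear hω
    induction ω with
    | nil => simp
    | cons s ω ih =>
      rw [List.map_cons, wordProd_cons, wordProd_cons, map_mul, ih]
      exact congrArg (· * _) (groupAction_simple g s)
  rw [this, hω.eq]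
  exact (M.toCoxeterSystem.length_wordProd_le _).trans (by simp)

theorem length_groupAction (g : symmetryGroup M) (w : M.Group) :
    M.toCoxeterSystem.length (groupAction g w) = M.toCoxeterSystem.length w := by
  refine le_antisymm (length_groupAction_le g w) ?_
  have := length_groupAction_le g⁻¹ (groupAction g w)
  rwa [← groupAction_mul, inv_mul_cancel, groupAction_one] at this

theorem mem_orbit_iff {s t : S} :
    t ∈ MulAction.orbit G s ↔ ∃ g ∈ G, (g : Equiv.Perm S) s = t :=
  ⟨fun ⟨g, hg⟩ => ⟨g, g.2, hg⟩, fun ⟨g, hg, e⟩ => ⟨⟨g, hg⟩, e⟩⟩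

theorem apply_mem_admissibleOrbit {X : Finset S} (hX : X ∈ admissibleOrbits G)
    {g : symmetryGroup M} (hg : g ∈ G) {s : S} : (g : Equiv.Perm S) s ∈ X ↔ s ∈ X := by
  obtain ⟨⟨a, ha⟩, -⟩ := hX
  rw [← Finset.mem_coe, ← Finset.mem_coe, ha]
  rw [← MulAction.orbit_eq_iff, ← MulAction.orbit_eq_iff (a := s),
    show (g : Equiv.Perm S) s = (⟨g, hg⟩ : G) • s from rfl, MulAction.orbit_smul]

theorem exists_apply_eq_of_mem_admissibleOrbit {X : Finset S} (hX : X ∈ admissibleOrbits G)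
    {s t : S} (hs : s ∈ X) (ht : t ∈ X) : ∃ g ∈ G, (g : Equiv.Perm S) s = t := by
  obtain ⟨⟨a, ha⟩, -⟩ := hX
  rw [← Finset.mem_coe, ha] at hs ht
  rw [← mem_orbit_iff, MulAction.orbit_eq_iff.2 hs]
  exact ht

theorem IsLongestElement.groupAction {X : Finset S} (hX : X ∈ admissibleOrbits G) {u : M.Group}
    (hu : IsLongestElement M (X : Set S) u) {g : symmetryGroup M} (hg : g ∈ G) :
    IsLongestElement M (X : Set S) (groupAction g u) := by
  constructor
  · have h1 : Subgroup.map (CoxeterSymmetry.groupAction g) (standardParabolic M (X : Set S)) ≤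
        standardParabolic M (X : Set S) := by
      rw [standardParabolic, MonoidHom.map_closure, Subgroup.closure_le]
      rintro _ ⟨_, ⟨s, hs, rfl⟩, rfl⟩
      rw [groupAction_simple]
      exact RootPrebasis.simple_mem_standardParabolic ((apply_mem_admissibleOrbit hX hg).2 hs)
    exact h1 ⟨u, hu.1, rfl⟩
  · intro s hs
    obtain ⟨t, rfl⟩ := (g : Equiv.Perm S).surjective s
    rw [← groupAction_simple, ← map_mul, length_groupAction, length_groupAction]
    exact hu.2 t ((apply_mem_admissibleOrbit hX hg).1 hs)

namespace RootPrebasis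

variable {B : RootPrebasis M}

theorem IsReduced.isLongestElement_mem_fixedSubgroup (h : B.IsReduced) {X : Finset S}
    (hX : X ∈ admissibleOrbits G) {u : M.Group} (hu : IsLongestElement M (X : Set S) u) :
    u ∈ fixedSubgroup G :=
  fun _ hg => h.isLongestElement_unique (hu.groupAction hX hg) hu

/-- Only finitely many simple reflections are left descents of a given element, namely some of
those which occur in a word representing it. -/
theorem IsReduced.finite_isLeftDescent (h : B.IsReduced) (w : M.Group) :
    {s | M.toCoxeterSystem.IsLeftDescent w s}.Finite := by
  obtain ⟨ω, e⟩ := M.toCoxeterSystem.wordProd_surjective w⁻¹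
  have hw : w⁻¹ ∈ standardParabolic M {s | s ∈ ω} := by
    rw [← e]
    refine Subgroup.list_prod_mem _ fun x hx => ?_
    obtain ⟨s, hs, rfl⟩ := List.mem_map.1 hx
    exact simple_mem_standardParabolic hs
  refine (List.finite_toSet ω).subset fun s hs => ?_
  exact h.mem_of_isRightDescent (fun x r hr => B.rep_apply_of_notMem hw x hr)
    (M.toCoxeterSystem.isRightDescent_inv_iff.2 hs)

/-- The fixed subgroup `W^G` is generated by the longest elements of the finite parabolic subgroups
attached to the finite orbits: the left descents of a fixed element `w ≠ 1` form a finite union of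
orbits, and if `X` is one of them then `W_X` is finite and `u_X⁻¹ w` is shorter than `w`. -/
theorem IsReduced.fixedSubgroup_eq_longestSubgroup (h : B.IsReduced)
    (G : Subgroup (symmetryGroup M)) : fixedSubgroup G = longestSubgroup G := by
  apply le_antisymm
  · intro w
    induction hn : M.toCoxeterSystem.length w using Nat.strong_induction_on generalizing w with
    | _ n ih =>
    intro hw
    by_cases h1 : w = 1
    · rw [h1]; exact one_mem _
    obtain ⟨s, hs⟩ := M.toCoxeterSystem.exists_leftDescent_of_ne_one h1
    have hd : ∀ t ∈ MulAction.orbit G s, M.toCoxeterSystem.IsLeftDescent w t := by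
      intro t ht
      obtain ⟨g, hg, rfl⟩ := mem_orbit_iff.1 ht
      have hs' : M.toCoxeterSystem.length (M.simple s * w) < M.toCoxeterSystem.length w := hs
      rw [← length_groupAction g, ← length_groupAction g w, map_mul, hw g hg,
        groupAction_simple] at hs'
      exact hs'
    have hfin : (MulAction.orbit G s).Finite := (h.finite_isLeftDescent w).subset hd
    obtain ⟨u, hu, hlt⟩ :=
      h.exists_isLongestElement_of_descents (MulAction.nonempty_orbit (M := G) s) hd
    have hX : hfin.toFinset ∈ admissibleOrbits G := by
      refine ⟨⟨s, hfin.coe_toFinset⟩, ?_⟩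
      rw [hfin.coe_toFinset]
      exact h.finite_standardParabolic hfin hu
    have hu' : IsLongestElement M (hfin.toFinset : Set S) u := by rwa [hfin.coe_toFinset]
    have huL : u ∈ longestSubgroup G := Subgroup.subset_closure ⟨_, hX, hu'⟩
    have h2 := ih _ (hn ▸ hlt) rfl
      (mul_mem (inv_mem (h.isLongestElement_mem_fixedSubgroup hX hu')) hw)
    have h3 := mul_mem huL h2
    rwa [mul_inv_cancel_left] at h3
  · rw [longestSubgroup, Subgroup.closure_le]
    rintro u ⟨X, hX, hu⟩
    exact h.isLongestElement_mem_fixedSubgroup hX hu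

end RootPrebasis

theorem mem_finVertices_of_mem_admissibleOrbit {X : Finset S} (hX : X ∈ admissibleOrbits G)
    {s : S} (hs : s ∈ X) : s ∈ finVertices G := by
  obtain ⟨⟨a, ha⟩, -⟩ := hX
  rw [← Finset.mem_coe, ha] at hs
  rw [finVertices, Set.mem_ofPred_eq, MulAction.orbit_eq_iff.2 hs, ← ha]
  exact X.finite_toSet

theorem RootPrebasis.IsReduced.fixedSubgroup_le_standardParabolic {B : RootPrebasis M}
    (h : B.IsReduced) (G : Subgroup (symmetryGroup M)) :
    fixedSubgroup G ≤ standardParabolic M (finVertices G) := by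
  rw [h.fixedSubgroup_eq_longestSubgroup, longestSubgroup, Subgroup.closure_le]
  rintro u ⟨X, hX, hu⟩
  exact Subgroup.closure_mono
    (Set.image_mono fun s hs => mem_finVertices_of_mem_admissibleOrbit hX hs) hu.1

end Fixed

/-! ### The folded root system -/

section Folding

variable {S : Type*} {M : CoxeterMatrix S} {G : Subgroup (symmetryGroup M)}

theorem spaceAction_apply_apply (g : symmetryGroup M) (x : S →₀ ℝ) (s : S) :
    spaceAction g x ((g : Equiv.Perm S) s) = x s := by
  simp [spaceAction]

theorem spaceAction_simpleRoot (g : symmetryGroup M) (s : S) :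
    spaceAction g (simpleRoot s) = simpleRoot ((g : Equiv.Perm S) s) := by
  simp [simpleRoot, spaceAction]

theorem spaceAction_nonneg (g : symmetryGroup M) {x : S →₀ ℝ} (hx : 0 ≤ x) :
    0 ≤ spaceAction g x := by
  intro s
  obtain ⟨t, rfl⟩ := (g : Equiv.Perm S).surjective s
  rw [spaceAction_apply_apply]
  exact hx t

theorem hatSimpleRoot_apply [DecidableEq S] (X : Finset S) (s : S) :
    hatSimpleRoot X s = if s ∈ X then 1 else 0 := by
  simp [hatSimpleRoot, simpleRoot, Finsupp.finsetSum_apply, Finsupp.single_apply]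

theorem spaceAction_hatSimpleRoot {X : Finset S} (hX : X ∈ admissibleOrbits G)
    {g : symmetryGroup M} (hg : g ∈ G) : spaceAction g (hatSimpleRoot X) = hatSimpleRoot X := by
  classical
  ext s
  obtain ⟨t, rfl⟩ := (g : Equiv.Perm S).surjective s
  rw [spaceAction_apply_apply, hatSimpleRoot_apply, hatSimpleRoot_apply]
  simp only [apply_mem_admissibleOrbit hX hg]

theorem eq_of_mem_admissibleOrbits {X Y : Finset S} (hX : X ∈ admissibleOrbits G)
    (hY : Y ∈ admissibleOrbits G) {s : S} (hsX : s ∈ X) (hsY : s ∈ Y) : X = Y := by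
  ext t
  constructor <;> intro ht
  · obtain ⟨g, hg, rfl⟩ := exists_apply_eq_of_mem_admissibleOrbit hX hsX ht
    exact (apply_mem_admissibleOrbit hY hg).2 hsY
  · obtain ⟨g, hg, rfl⟩ := exists_apply_eq_of_mem_admissibleOrbit hY hsY ht
    exact (apply_mem_admissibleOrbit hX hg).2 hsX

theorem nonempty_of_mem_admissibleOrbits {X : Finset S} (hX : X ∈ admissibleOrbits G) :
    X.Nonempty := by
  obtain ⟨⟨a, ha⟩, -⟩ := hX
  rw [← Finset.coe_nonempty, ha]
  exact MulAction.nonempty_orbit a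

theorem sum_hatSimpleRoot_apply (c : admissibleOrbits G →₀ ℝ) (X : admissibleOrbits G) {s : S}
    (hs : s ∈ (X : Finset S)) :
    (c.sum fun Y a => a • hatSimpleRoot (Y : Finset S)) s = c X := by
  classical
  rw [Finsupp.sum, Finsupp.finsetSum_apply, Finset.sum_eq_single X]
  · rw [Finsupp.smul_apply, hatSimpleRoot_apply, if_pos hs, smul_eq_mul, mul_one]
  · intro Y _ hYX
    rw [Finsupp.smul_apply, hatSimpleRoot_apply, if_neg, smul_zero]
    exact fun hsY => hYX (Subtype.ext (eq_of_mem_admissibleOrbits Y.2 X.2 hsY hs))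
  · intro hX
    rw [Finsupp.notMem_support_iff.1 hX, zero_smul, Finsupp.zero_apply]

namespace RootPrebasis

variable {B : RootPrebasis M}

theorem IsSymmetric.spaceAction_rep (hB : B.IsSymmetric G) {g : symmetryGroup M} (hg : g ∈ G)
    (w : M.Group) (x : S →₀ ℝ) :
    spaceAction g (B.rep w x) = B.rep (groupAction g w) (spaceAction g x) := by
  rw [hB.rep_equivariant hg]
  change _ = (spaceAction g) ((B.rep w) ((spaceAction g)⁻¹ ((spaceAction g) x)))
  rw [← LinearEquiv.mul_apply (spaceAction g)⁻¹, inv_mul_cancel, LinearEquiv.coe_one, id]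

theorem IsSymmetric.spaceAction_rep_simpleRoot (hB : B.IsSymmetric G) {g : symmetryGroup M}
    (hg : g ∈ G) (w : M.Group) (s : S) :
    spaceAction g (B.rep w (simpleRoot s)) =
      B.rep (groupAction g w) (simpleRoot ((g : Equiv.Perm S) s)) := by
  rw [hB.spaceAction_rep hg, spaceAction_simpleRoot]

/-- The subspace `V̂` of `V` spanned by the vectors `α̂_X`. -/
def hatSpace (G : Subgroup (symmetryGroup M)) : Submodule ℝ (S →₀ ℝ) :=
  Submodule.span ℝ (Set.range fun X : admissibleOrbits G => hatSimpleRoot (X : Finset S))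

theorem hatSimpleRoot_mem_hatSpace {X : Finset S} (hX : X ∈ admissibleOrbits G) :
    hatSimpleRoot X ∈ hatSpace G :=
  Submodule.subset_span ⟨⟨X, hX⟩, rfl⟩

/-- A fixed element of `W_Y`, where `Y` is an orbit, adds to `α̂_X` a `G`-invariant vector of `V_Y`,
which is a multiple of `α̂_Y`. -/
theorem IsSymmetric.rep_mem_hatSpace_of_mem_standardParabolic (hB : B.IsSymmetric G) {Y : Finset S}
    (hY : Y ∈ admissibleOrbits G) {u : M.Group} (hu : u ∈ standardParabolic M (Y : Set S))
    (huG : u ∈ fixedSubgroup G) {x : S →₀ ℝ} (hx : x ∈ hatSpace G) :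
    B.rep u x ∈ hatSpace G := by
  classical
  induction hx using Submodule.span_induction with
  | zero => rw [map_zero]; exact zero_mem _
  | add x y _ _ hx hy => rw [map_add]; exact add_mem hx hy
  | smul a x _ hx => rw [map_smul]; exact Submodule.smul_mem _ a hx
  | mem x hx =>
    obtain ⟨⟨X, hX⟩, rfl⟩ := hx
    obtain ⟨a, ha⟩ := nonempty_of_mem_admissibleOrbits hY
    set y := B.rep u (hatSimpleRoot X) - hatSimpleRoot X with hy
    have hinv : ∀ g ∈ G, ∀ r, y ((g : Equiv.Perm S) r) = y r := by
      intro g hg r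
      have : spaceAction g y = y := by
        rw [hy, map_sub, hB.spaceAction_rep hg, huG g hg, spaceAction_hatSimpleRoot hX hg]
      rw [← spaceAction_apply_apply g y r, this]
    have hya : y = y a • hatSimpleRoot Y := by
      ext r
      rw [Finsupp.smul_apply, hatSimpleRoot_apply]
      by_cases hr : r ∈ Y
      · obtain ⟨g, hg, rfl⟩ := exists_apply_eq_of_mem_admissibleOrbit hY ha hr
        rw [if_pos hr, smul_eq_mul, mul_one, hinv g hg]
      · rw [if_neg hr, smul_zero, hy, Finsupp.sub_apply,
          B.rep_apply_of_notMem hu _ (by simpa using hr), sub_self]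
    have e : B.rep u (hatSimpleRoot X) = y + hatSimpleRoot X := by rw [hy, sub_add_cancel]
    change B.rep u (hatSimpleRoot X) ∈ _
    rw [e, hya]
    exact add_mem (Submodule.smul_mem _ _ (hatSimpleRoot_mem_hatSpace hY))
      (hatSimpleRoot_mem_hatSpace hX)

theorem IsSymmetric.rep_mem_hatSpace (hB : B.IsSymmetric G) (h : B.IsReduced) {w : M.Group}
    (hw : w ∈ fixedSubgroup G) {x : S →₀ ℝ} (hx : x ∈ hatSpace G) : B.rep w x ∈ hatSpace G := by
  rw [h.fixedSubgroup_eq_longestSubgroup] at hw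
  suffices ∀ x ∈ hatSpace G, B.rep w x ∈ hatSpace G ∧ B.rep w⁻¹ x ∈ hatSpace G from (this x hx).1
  induction hw using Subgroup.closure_induction with
  | mem u hu =>
    obtain ⟨X, hX, hu⟩ := hu
    have huG := h.isLongestElement_mem_fixedSubgroup hX hu
    exact fun x hx => ⟨hB.rep_mem_hatSpace_of_mem_standardParabolic hX hu.1 huG hx,
      hB.rep_mem_hatSpace_of_mem_standardParabolic hX (inv_mem hu.1) (inv_mem huG) hx⟩
  | one =>
    intro x hx
    rw [inv_one, map_one]
    exact ⟨hx, hx⟩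
  | mul a b _ _ iha ihb =>
    intro x hx
    rw [mul_inv_rev, rep_mul_apply, rep_mul_apply]
    exact ⟨(iha _ (ihb x hx).1).1, (ihb _ (iha x hx).2).2⟩
  | inv a _ iha =>
    intro x hx
    rw [inv_inv]
    exact (iha x hx).symm

/-- If `w ∈ W^G`, then `w (α̂_X)` belongs to `Φ̂⁺` as soon as its coordinates in `V` are
nonnegative. -/
theorem IsSymmetric.rep_hatSimpleRoot_mem_hatPosRoots (hB : B.IsSymmetric G) (h : B.IsReduced)
    {w : M.Group} (hw : w ∈ fixedSubgroup G) {X : Finset S} (hX : X ∈ admissibleOrbits G)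
    (h0 : 0 ≤ B.rep w (hatSimpleRoot X)) : B.rep w (hatSimpleRoot X) ∈ B.hatPosRoots G := by
  refine ⟨⟨w, h.fixedSubgroup_eq_longestSubgroup G ▸ hw, X, hX, rfl⟩, ?_⟩
  obtain ⟨c, hc⟩ := Finsupp.mem_span_range_iff_exists_finsupp.1
    (hB.rep_mem_hatSpace h hw (hatSimpleRoot_mem_hatSpace hX))
  refine ⟨c, fun Y => ?_, hc.symm⟩
  obtain ⟨s, hs⟩ := nonempty_of_mem_admissibleOrbits Y.2
  rw [← sum_hatSimpleRoot_apply c Y hs, hc]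
  exact h0 s

/-- A positive root `w (α_s)` with `w ∈ W^G` and `s` in an admissible orbit `X` belongs to the orbit
`w (ω_X)`, which is in the image of the map `F`. -/
theorem IsSymmetric.exists_FGraph (hB : B.IsSymmetric G) (h : B.IsReduced) {w : M.Group}
    (hw : w ∈ fixedSubgroup G) {X : Finset S} (hX : X ∈ admissibleOrbits G) {s : S} (hs : s ∈ X)
    (β : B.posRoots) (hβ : (β : S →₀ ℝ) = B.rep w (simpleRoot s)) :
    ∃ v ω, B.FGraph G v ω ∧ β ∈ ω := by
  have hpos : ∀ t ∈ X, 0 ≤ B.rep w (simpleRoot t) := by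
    intro t ht
    obtain ⟨g, hg, rfl⟩ := exists_apply_eq_of_mem_admissibleOrbit hX hs ht
    have e := hB.spaceAction_rep_simpleRoot hg w s
    rw [hw g hg] at e
    rw [← e, ← hβ]
    exact spaceAction_nonneg g β.2.2
  have hfin : (Subtype.val ⁻¹' ((fun t => B.rep w (simpleRoot t)) '' (X : Set S)) :
      Set B.posRoots).Finite :=
    Set.Finite.preimage Subtype.val_injective.injOn (X.finite_toSet.image _)
  refine ⟨B.rep w (hatSimpleRoot X), hfin.toFinset,
    ⟨hB.rep_hatSimpleRoot_mem_hatPosRoots h hw hX ?_, w, hw, X, hX, rfl, ?_⟩, ?_⟩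
  · rw [hatSimpleRoot, map_sum]
    exact Finset.sum_nonneg hpos
  · rw [hfin.coe_toFinset, Subtype.image_preimage_coe, Set.inter_eq_right]
    rintro _ ⟨t, ht, rfl⟩
    exact ⟨B.rep_simpleRoot_mem_roots w t, hpos t ht⟩
  · rw [hfin.mem_toFinset]
    exact ⟨s, hs, hβ.symm⟩

theorem coe_posRootAction (hB : B.IsSymmetric G) (g : G) (β : B.posRoots) :
    (posRootAction hB g β : S →₀ ℝ) = spaceAction (g : symmetryGroup M) β := rfl

theorem posRootAction_injective (hB : B.IsSymmetric G) (g : G) :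
    Function.Injective (posRootAction hB g) := fun _ _ e =>
  Subtype.ext ((spaceAction (g : symmetryGroup M)).injective (congrArg Subtype.val e))

theorem posRootAction_surjective (hB : B.IsSymmetric G) (g : G) :
    Function.Surjective (posRootAction hB g) := fun β => by
  refine ⟨posRootAction hB g⁻¹ β, Subtype.ext ?_⟩
  ext s
  obtain ⟨t, rfl⟩ := ((g : symmetryGroup M) : Equiv.Perm S).surjective s
  rw [coe_posRootAction, coe_posRootAction, spaceAction_apply_apply,
    ← spaceAction_apply_apply ((g⁻¹ : G) : symmetryGroup M) _
      (((g : symmetryGroup M) : Equiv.Perm S) t)]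
  congr 1
  simp

theorem posRootAction_mul (hB : B.IsSymmetric G) (g k : G) (β : B.posRoots) :
    posRootAction hB (g * k) β = posRootAction hB g (posRootAction hB k β) := by
  refine Subtype.ext ?_
  ext s
  obtain ⟨t, rfl⟩ := ((g * k : symmetryGroup M) : Equiv.Perm S).surjective s
  rw [coe_posRootAction, coe_posRootAction, coe_posRootAction]
  refine (spaceAction_apply_apply _ _ t).trans ?_
  rw [Subgroup.coe_mul, Equiv.Perm.mul_apply, spaceAction_apply_apply, spaceAction_apply_apply]

theorem posRootAction_one (hB : B.IsSymmetric G) (β : B.posRoots) :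
    posRootAction hB 1 β = β := by
  refine Subtype.ext ?_
  ext s
  exact spaceAction_apply_apply 1 (β : S →₀ ℝ) s

theorem FGraph.nonempty {v : S →₀ ℝ} {ω : Finset B.posRoots} (hω : B.FGraph G v ω) :
    ω.Nonempty := by
  obtain ⟨-, w, -, X, hX, -, e⟩ := hω
  have := ((nonempty_of_mem_admissibleOrbits hX).to_set.image
    fun s => B.rep w (simpleRoot s))
  rw [← e] at this
  exact Finset.coe_nonempty.1 this.of_image

theorem FGraph.posRootAction_mem (hB : B.IsSymmetric G) {v : S →₀ ℝ} {ω : Finset B.posRoots}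
    (hω : B.FGraph G v ω) (g : G) {β : B.posRoots} :
    posRootAction hB g β ∈ ω ↔ β ∈ ω := by
  obtain ⟨-, w, hw, X, hX, -, e⟩ := hω
  have hmem : ∀ γ : B.posRoots, γ ∈ ω ↔ ∃ s ∈ X, B.rep w (simpleRoot s) = γ := by
    intro γ
    rw [← Finset.mem_coe, ← Subtype.val_injective.mem_set_image, e]
    rfl
  have key : ∀ s, spaceAction (g : symmetryGroup M) (B.rep w (simpleRoot s)) =
      B.rep w (simpleRoot (((g : symmetryGroup M) : Equiv.Perm S) s)) := fun s => by
    rw [hB.spaceAction_rep_simpleRoot g.2, hw _ g.2]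
  rw [hmem, hmem]
  constructor
  · rintro ⟨s, hs, es⟩
    obtain ⟨t, rfl⟩ := ((g : symmetryGroup M) : Equiv.Perm S).surjective s
    refine ⟨t, (apply_mem_admissibleOrbit hX g.2).1 hs, ?_⟩
    rw [← key] at es
    exact (spaceAction (g : symmetryGroup M)).injective es
  · rintro ⟨s, hs, es⟩
    refine ⟨_, (apply_mem_admissibleOrbit hX g.2).2 hs, ?_⟩
    rw [← key, es]
    rfl

theorem FGraph.exists_posRootAction_eq (hB : B.IsSymmetric G) {v : S →₀ ℝ}
    {ω : Finset B.posRoots} (hω : B.FGraph G v ω) {β γ : B.posRoots} (hβ : β ∈ ω) (hγ : γ ∈ ω) :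
    ∃ g : G, posRootAction hB g β = γ := by
  obtain ⟨-, w, hw, X, hX, -, e⟩ := hω
  have hmem : ∀ γ : B.posRoots, γ ∈ ω → ∃ s ∈ X, B.rep w (simpleRoot s) = γ := by
    intro γ hγ
    rw [← Finset.mem_coe, ← Subtype.val_injective.mem_set_image, e] at hγ
    exact hγ
  obtain ⟨s, hs, es⟩ := hmem β hβ
  obtain ⟨t, ht, et⟩ := hmem γ hγ
  obtain ⟨g, hg, rfl⟩ := exists_apply_eq_of_mem_admissibleOrbit hX hs ht
  refine ⟨⟨g, hg⟩, Subtype.ext ?_⟩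
  rw [coe_posRootAction, ← es, ← et, hB.spaceAction_rep_simpleRoot hg, hw g hg]

/-! ### The basis property in terms of orbits of roots -/

theorem mem_fixedSpace_iff {K : Type*} [Field K] (hB : B.IsSymmetric G) {x : B.posRoots →₀ K} :
    x ∈ fixedSpace K hB ↔ ∀ (g : G) (β : B.posRoots), x (posRootAction hB g β) = x β := by
  simp only [fixedSpace, Submodule.mem_iInf, LinearMap.mem_eqLocus, LinearMap.id_apply,
    Finsupp.lmapDomain_apply]
  refine forall_congr' fun g => ?_
  constructor
  · intro e β
    conv_lhs => rw [← e]
    exact Finsupp.mapDomain_apply (posRootAction_injective hB g) x β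
  · intro e
    ext γ
    obtain ⟨β, rfl⟩ := posRootAction_surjective hB g γ
    rw [Finsupp.mapDomain_apply (posRootAction_injective hB g), e]

theorem sum_single_apply {K ι : Type*} [Field K] [DecidableEq ι] (ω : Finset ι) (β : ι) :
    (∑ γ ∈ ω, Finsupp.single γ (1 : K)) β = if β ∈ ω then 1 else 0 := by
  simp [Finsupp.finsetSum_apply, Finsupp.single_apply]

theorem FGraph.eq_of_mem (hB : B.IsSymmetric G) {v v' : S →₀ ℝ} {ω ω' : Finset B.posRoots}
    (hω : B.FGraph G v ω) (hω' : B.FGraph G v' ω') {β : B.posRoots} (h : β ∈ ω) (h' : β ∈ ω') :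
    ω = ω' := by
  ext γ
  constructor <;> intro hγ
  · obtain ⟨g, rfl⟩ := hω.exists_posRootAction_eq hB h hγ
    exact (hω'.posRootAction_mem hB g).2 h'
  · obtain ⟨g, rfl⟩ := hω'.exists_posRootAction_eq hB h' hγ
    exact (hω.posRootAction_mem hB g).2 h

/-- The vectors `ê_ω`, with `ω` in the image of `F`, have disjoint supports. -/
theorem linearIndependent_hatFamily {K : Type*} [Field K] (hB : B.IsSymmetric G) :
    LinearIndependent K (Subtype.val : B.hatFamily G K → (B.posRoots →₀ K)) := by
  classical
  rw [linearIndependent_iff']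
  intro t c hc x hx
  obtain ⟨v, ω, hω, ex⟩ := x.2
  obtain ⟨β, hβ⟩ := hω.nonempty
  have h1 := DFunLike.congr_fun hc β
  rw [Finsupp.finsetSum_apply, Finset.sum_eq_single_of_mem x hx] at h1
  · rwa [Finsupp.smul_apply, ex, sum_single_apply, if_pos hβ, smul_eq_mul, mul_one] at h1
  · intro y _ hyx
    obtain ⟨v', ω', hω', ey⟩ := y.2
    rw [Finsupp.smul_apply, ey, sum_single_apply, if_neg, smul_zero]
    intro hβ'
    refine hyx (Subtype.ext ?_)
    rw [ex, ey, hω.eq_of_mem hB hω' hβ hβ']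

theorem sum_single_mem_fixedSpace {K : Type*} [Field K] (hB : B.IsSymmetric G)
    {ω : Finset B.posRoots} (hω : ∀ (g : G) (β), posRootAction hB g β ∈ ω ↔ β ∈ ω) :
    ∑ β ∈ ω, Finsupp.single β (1 : K) ∈ fixedSpace K hB := by
  classical
  rw [mem_fixedSpace_iff]
  intro g β
  rw [sum_single_apply, sum_single_apply]
  simp only [hω]

/-- The basis property says that every finite orbit of positive roots is in the image of `F`. -/
theorem hasBasisProperty_iff {K : Type*} [Field K] (hB : B.IsSymmetric G) :
    HasBasisProperty K hB ↔ ∀ β : B.posRoots, (Set.range fun g : G => posRootAction hB g β).Finite →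
      ∃ v ω, B.FGraph G v ω ∧ β ∈ ω := by
  classical
  constructor
  · rintro ⟨-, hspan⟩ β hβ
    have hmem : ∑ γ ∈ hβ.toFinset, Finsupp.single γ (1 : K) ∈ fixedSpace K hB := by
      refine sum_single_mem_fixedSpace hB fun g γ => ?_
      simp only [Set.Finite.mem_toFinset, Set.mem_range]
      constructor
      · rintro ⟨k, hk⟩
        refine ⟨g⁻¹ * k, posRootAction_injective hB g ?_⟩
        rw [← posRootAction_mul, mul_inv_cancel_left, hk]
      · rintro ⟨k, rfl⟩
        exact ⟨g * k, posRootAction_mul hB g k β⟩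
    rw [← hspan] at hmem
    by_contra hno
    have hzero : ∀ x ∈ Submodule.span K (B.hatFamily G K), x β = 0 := by
      intro x hx
      induction hx using Submodule.span_induction with
      | zero => rfl
      | add x y _ _ hx hy => rw [Finsupp.add_apply, hx, hy, add_zero]
      | smul a x _ hx => rw [Finsupp.smul_apply, hx, smul_zero]
      | mem x hx =>
        obtain ⟨v, ω, hω, rfl⟩ := hx
        rw [sum_single_apply, if_neg]
        exact fun hβω => hno ⟨v, ω, hω, hβω⟩
    have h1 := hzero _ hmem
    rw [sum_single_apply, if_pos] at h1
    · exact one_ne_zero h1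
    · rw [Set.Finite.mem_toFinset]
      exact ⟨1, posRootAction_one hB β⟩
  · intro hcov
    refine ⟨linearIndependent_hatFamily hB, le_antisymm (Submodule.span_le.2 ?_) ?_⟩
    · rintro _ ⟨v, ω, hω, rfl⟩
      exact sum_single_mem_fixedSpace hB fun g β => hω.posRootAction_mem hB g
    · -- Subtract from a fixed vector its component along an orbit contained in its support.
      intro x hx
      induction hn : x.support.card using Nat.strong_induction_on generalizing x with
      | _ n ih =>
      by_cases hx0 : x = 0
      · rw [hx0]; exact zero_mem _
      obtain ⟨β, hβ⟩ := Finsupp.support_nonempty_iff.2 hx0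
      have hxinv := (mem_fixedSpace_iff hB).1 hx
      obtain ⟨v, ω, hω, hβω⟩ := hcov β (x.support.finite_toSet.subset (by
        rintro _ ⟨g, rfl⟩
        rw [Finset.mem_coe, Finsupp.mem_support_iff, hxinv]
        exact Finsupp.mem_support_iff.1 hβ))
      set e := ∑ γ ∈ ω, Finsupp.single γ (1 : K) with he
      have heF : e ∈ fixedSpace K hB :=
        sum_single_mem_fixedSpace hB fun g β => hω.posRootAction_mem hB g
      have hconst : ∀ γ ∈ ω, x γ = x β := by
        intro γ hγ
        obtain ⟨g, rfl⟩ := hω.exists_posRootAction_eq hB hβω hγ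
        exact hxinv g β
      have hval : ∀ γ, (x - x β • e) γ = if γ ∈ ω then 0 else x γ := by
        intro γ
        rw [Finsupp.sub_apply, Finsupp.smul_apply, he, sum_single_apply]
        split_ifs with hγ
        · rw [hconst γ hγ, smul_eq_mul, mul_one, sub_self]
        · rw [smul_zero, sub_zero]
      have hlt : (x - x β • e).support.card < n := by
        rw [← hn]
        refine Finset.card_lt_card ((Finset.ssubset_iff_of_subset fun γ hγ => ?_).2 ⟨β, hβ, ?_⟩)
        · rw [Finsupp.mem_support_iff, hval] at hγ
          rw [Finsupp.mem_support_iff]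
          split_ifs at hγ
          · exact absurd rfl hγ
          · exact hγ
        · rw [Finsupp.notMem_support_iff, hval, if_pos hβω]
      have h1 := ih _ hlt (sub_mem hx (Submodule.smul_mem _ _ heF)) rfl
      have h2 : e ∈ Submodule.span K (B.hatFamily G K) :=
        Submodule.subset_span ⟨v, ω, hω, rfl⟩
      have h3 := add_mem h1 (Submodule.smul_mem _ (x β) h2)
      rwa [sub_add_cancel] at h3

end RootPrebasis

/-! ### The basis property in terms of reflections -/

/-- Every reflection of the Coxeter group whose orbit under `G` is finite is conjugate, by an
element of `W^G`, to the generator attached to an element of an admissible orbit. -/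
def FiniteOrbitReflectionsFold (G : Subgroup (symmetryGroup M)) : Prop :=
  ∀ (x : M.Group) (a : S),
    (Set.range fun g : G => groupAction (g : symmetryGroup M) (x * M.simple a * x⁻¹)).Finite →
      ∃ w ∈ fixedSubgroup G, ∃ X ∈ admissibleOrbits G, ∃ s ∈ X,
        x * M.simple a * x⁻¹ = w * M.simple s * w⁻¹

theorem finite_range_of_forall_eq {ι α β : Type*} {f : ι → α} {f' : ι → β}
    (hf : (Set.range f).Finite) (h : ∀ i j, f i = f j → f' i = f' j) : (Set.range f').Finite := by
  have := hf.to_subtype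
  refine Set.finite_range (fun y : Set.range f => f' y.2.choose) |>.subset ?_
  rintro _ ⟨i, rfl⟩
  exact ⟨⟨f i, i, rfl⟩, h _ _ (Exists.choose_spec (⟨i, rfl⟩ : ∃ j, f j = f i))⟩

namespace RootPrebasis

variable {B : RootPrebasis M}

/-- A positive root and its reflection have the same stabilizer in `G`. -/
theorem IsSymmetric.posRootAction_eq_iff (hB : B.IsSymmetric G) (h : B.IsReduced)
    {β : B.posRoots} {x : M.Group} {a : S} (hβ : (β : S →₀ ℝ) = B.rep x (simpleRoot a))
    (g k : G) :
    posRootAction hB g β = posRootAction hB k β ↔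
      groupAction (g : symmetryGroup M) (x * M.simple a * x⁻¹) =
        groupAction (k : symmetryGroup M) (x * M.simple a * x⁻¹) := by
  have hc : ∀ g : G, (posRootAction hB g β : S →₀ ℝ) =
      B.rep (groupAction (g : symmetryGroup M) x)
        (simpleRoot (((g : symmetryGroup M) : Equiv.Perm S) a)) := fun g => by
    rw [coe_posRootAction, hβ, hB.spaceAction_rep_simpleRoot g.2]
  simp only [map_mul, map_inv, groupAction_simple]
  rw [h.conj_eq_conj_iff, ← hc, ← hc, Subtype.ext_iff]
  refine ⟨Or.inl, fun h' => h'.resolve_right fun e => ?_⟩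
  refine not_nonpos_of_nonneg (posRootAction hB g β).2.1 (posRootAction hB g β).2.2 ?_
  rw [e]
  exact neg_nonpos.2 (posRootAction hB k β).2.2

theorem IsReduced.hasBasisProperty_iff_finiteOrbitReflectionsFold {K : Type*} [Field K]
    (h : B.IsReduced) (hB : B.IsSymmetric G) :
    HasBasisProperty K hB ↔ FiniteOrbitReflectionsFold G := by
  rw [hasBasisProperty_iff]
  constructor
  · intro hcov
    -- It is enough to consider reflections written with a positive root.
    have key : ∀ (x : M.Group) (a : S), 0 ≤ B.rep x (simpleRoot a) →
        (Set.range fun g : G =>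
          groupAction (g : symmetryGroup M) (x * M.simple a * x⁻¹)).Finite →
        ∃ w ∈ fixedSubgroup G, ∃ X ∈ admissibleOrbits G, ∃ s ∈ X,
          x * M.simple a * x⁻¹ = w * M.simple s * w⁻¹ := by
      intro x a h0 hfin
      let β : B.posRoots := ⟨B.rep x (simpleRoot a), B.rep_simpleRoot_mem_roots x a, h0⟩
      obtain ⟨v, ω, ⟨-, w, hw, X, hX, -, e⟩, hβω⟩ := hcov β
        (finite_range_of_forall_eq hfin fun g k hgk => (hB.posRootAction_eq_iff h rfl g k).2 hgk)
      have hβ' : (β : S →₀ ℝ) ∈ (fun s => B.rep w (simpleRoot s)) '' (X : Set S) := by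
        rw [← e]; exact ⟨β, hβω, rfl⟩
      obtain ⟨s, hs, es⟩ := hβ'
      exact ⟨w, hw, X, hX, s, hs, h.conj_eq_conj_iff.2 (Or.inl es.symm)⟩
    intro x a hfin
    rcases h.nonneg_or_nonpos (B.rep_simpleRoot_mem_roots x a) with h0 | h0
    · exact key x a h0 hfin
    · have e : x * M.simple a * x⁻¹ =
          (x * M.simple a) * M.simple a * (x * M.simple a)⁻¹ := by
        rw [mul_inv_rev, inv_simple, mul_assoc (x * M.simple a), ← mul_assoc (M.simple a),
          simple_mul_self, one_mul]
      rw [e] at hfin ⊢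
      refine key _ a ?_ hfin
      rw [rep_mul_apply, rep_simple, reflection_simpleRoot, map_neg]
      exact neg_nonneg.2 h0
  · intro hfold β hβ
    obtain ⟨x, a, e⟩ := β.2.1
    obtain ⟨w, hw, X, hX, s, hs, e2⟩ := hfold x a
      (finite_range_of_forall_eq hβ fun g k hgk => (hB.posRootAction_eq_iff h e g k).1 hgk)
    rcases h.conj_eq_conj_iff.1 e2 with e3 | e3
    · exact hB.exists_FGraph h hw hX hs β (e.trans e3)
    · obtain ⟨u, hu⟩ := exists_isLongestElement_of_finite hX.2
      obtain ⟨t, ht, e4⟩ := h.exists_rep_eq_neg hu hs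
      refine hB.exists_FGraph h (mul_mem hw (h.isLongestElement_mem_fixedSubgroup hX hu)) hX ht β ?_
      rw [e, e3, rep_mul_apply, e4, map_neg]

end RootPrebasis

end Folding

/-! ### Restriction to the finite orbits of vertices -/

section Subgraph

variable {S : Type*} {M : CoxeterMatrix S}

/-- The homomorphism from the Coxeter group of the full subgraph spanned by `X` to the Coxeter group
of `M` which sends each generator to the generator of the same name. -/
def subgraphHom (M : CoxeterMatrix S) (X : Set S) : (fullSubgraph M X).Group →* M.Group :=
  (fullSubgraph M X).toCoxeterSystem.lift ⟨fun s => M.simple (s : S), fun s t =>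
    M.toCoxeterSystem.simple_mul_simple_pow (s : S) (t : S)⟩

theorem subgraphHom_simple {X : Set S} (s : X) :
    subgraphHom M X ((fullSubgraph M X).simple s) = M.simple (s : S) :=
  (fullSubgraph M X).toCoxeterSystem.lift_apply_simple _ s

theorem RootPrebasis.IsReduced.subgraphHom_injective {B : RootPrebasis M} (h : B.IsReduced)
    (X : Set S) : Function.Injective (subgraphHom M X) :=
  Function.Injective.of_comp (f := B.rep)
    (h.map_injective (fullSubgraph M X).toCoxeterSystem Subtype.val_injective (fun _ _ => rfl)
      subgraphHom_simple)

theorem map_subgraphHom_standardParabolic (X : Set S) (Y : Set X) :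
    (standardParabolic (fullSubgraph M X) Y).map (subgraphHom M X) =
      standardParabolic M (Subtype.val '' Y) := by
  rw [standardParabolic, MonoidHom.map_closure, standardParabolic, Set.image_image, Set.image_image]
  simp only [subgraphHom_simple]

theorem exists_subgraphHom_eq {X : Set S} {w : M.Group} (hw : w ∈ standardParabolic M X) :
    ∃ w', subgraphHom M X w' = w := by
  rw [← Subtype.coe_image_univ X, ← map_subgraphHom_standardParabolic] at hw
  obtain ⟨w', -, e⟩ := hw
  exact ⟨w', e⟩

end Subgraph

section FiniteOrbits

variable {S : Type*} {M : CoxeterMatrix S} {G : Subgroup (symmetryGroup M)}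

theorem apply_mem_finVertices {g : symmetryGroup M} (hg : g ∈ G) {s : S} :
    (g : Equiv.Perm S) s ∈ finVertices G ↔ s ∈ finVertices G := by
  rw [finVertices, Set.mem_ofPred_eq, Set.mem_ofPred_eq,
    show (g : Equiv.Perm S) s = (⟨g, hg⟩ : G) • s from rfl, MulAction.orbit_smul]

/-- Every element of `G` induces an element of `G_fin`. -/
theorem exists_mem_finGroup {g : symmetryGroup M} (hg : g ∈ G) :
    ∃ k ∈ finGroup G, ∀ s : finVertices G,
      (((k : Equiv.Perm (finVertices G)) s : finVertices G) : S) = (g : Equiv.Perm S) s :=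
  ⟨⟨(g : Equiv.Perm S).subtypePerm fun _ => apply_mem_finVertices hg,
    fun s t => g.2 s t⟩, ⟨g, hg, fun _ => rfl⟩, fun _ => rfl⟩

theorem subgraphHom_groupAction {g : symmetryGroup M} {k : symmetryGroup (finGraph G)}
    (hk : ∀ s : finVertices G,
      (((k : Equiv.Perm (finVertices G)) s : finVertices G) : S) = (g : Equiv.Perm S) s)
    (w : (finGraph G).Group) :
    subgraphHom M (finVertices G) (groupAction k w) =
      groupAction g (subgraphHom M (finVertices G) w) := by
  have : (subgraphHom M (finVertices G)).comp (groupAction k) =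
      (groupAction g).comp (subgraphHom M (finVertices G)) :=
    (finGraph G).toCoxeterSystem.ext_simple fun s => by
      change subgraphHom M (finVertices G) (groupAction k ((finGraph G).simple s)) =
        groupAction g (subgraphHom M (finVertices G) ((finGraph G).simple s))
      rw [groupAction_simple, subgraphHom_simple, subgraphHom_simple, groupAction_simple, hk]
  exact DFunLike.congr_fun this w

theorem coe_image_orbit_finGroup (s : finVertices G) :
    Subtype.val '' MulAction.orbit (finGroup G) s = MulAction.orbit G (s : S) := by
  ext t
  constructor
  · rintro ⟨t, ht, rfl⟩
    obtain ⟨k, ⟨g, hg, hk⟩, rfl⟩ := mem_orbit_iff.1 ht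
    exact mem_orbit_iff.2 ⟨g, hg, (hk s).symm⟩
  · intro ht
    obtain ⟨g, hg, rfl⟩ := mem_orbit_iff.1 ht
    obtain ⟨k, hkG, hk⟩ := exists_mem_finGroup hg
    exact ⟨_, mem_orbit_iff.2 ⟨k, hkG, rfl⟩, hk s⟩

theorem map_mem_admissibleOrbits_iff
    (hinj : Function.Injective (subgraphHom M (finVertices G))) {X : Finset (finVertices G)} :
    X.map (Function.Embedding.subtype _) ∈ admissibleOrbits G ↔
      X ∈ admissibleOrbits (finGroup G) := by
  have hc : ((X.map (Function.Embedding.subtype _) : Finset S) : Set S) =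
      Subtype.val '' (X : Set (finVertices G)) := by simp
  rw [admissibleOrbits, admissibleOrbits, Set.mem_ofPred_eq, Set.mem_ofPred_eq, hc]
  refine and_congr ?_ ?_
  · constructor
    · rintro ⟨s, hs⟩
      have hs' : s ∈ Subtype.val '' (X : Set (finVertices G)) := by
        rw [hs]; exact MulAction.mem_orbit_self s
      obtain ⟨s, -, rfl⟩ := hs'
      refine ⟨s, Subtype.val_injective.image_injective ?_⟩
      rw [hs, coe_image_orbit_finGroup]
    · rintro ⟨s, hs⟩
      exact ⟨s, by rw [hs, coe_image_orbit_finGroup]⟩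
  · rw [← map_subgraphHom_standardParabolic, Subgroup.coe_map]
    exact Set.finite_image_iff hinj.injOn

theorem subgraphHom_mem_fixedSubgroup_iff
    (hinj : Function.Injective (subgraphHom M (finVertices G))) {w : (finGraph G).Group} :
    subgraphHom M (finVertices G) w ∈ fixedSubgroup G ↔ w ∈ fixedSubgroup (finGroup G) := by
  constructor
  · rintro hw k ⟨g, hg, hk⟩
    exact hinj (by rw [subgraphHom_groupAction hk, hw g hg])
  · intro hw g hg
    obtain ⟨k, hkG, hk⟩ := exists_mem_finGroup hg
    rw [← subgraphHom_groupAction hk, hw k hkG]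

theorem finite_range_subgraphHom_iff
    (hinj : Function.Injective (subgraphHom M (finVertices G))) (w : (finGraph G).Group) :
    (Set.range fun g : G => groupAction (g : symmetryGroup M)
      (subgraphHom M (finVertices G) w)).Finite ↔
    (Set.range fun k : finGroup G => groupAction (k : symmetryGroup (finGraph G)) w).Finite := by
  rw [← Set.finite_image_iff (hinj.injOn
    (s := Set.range fun k : finGroup G => groupAction (k : symmetryGroup (finGraph G)) w))]
  refine iff_of_eq (congrArg Set.Finite ?_)
  ext y
  constructor
  · rintro ⟨g, rfl⟩
    obtain ⟨k, hkG, hk⟩ := exists_mem_finGroup g.2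
    exact ⟨_, ⟨⟨k, hkG⟩, rfl⟩, subgraphHom_groupAction hk w⟩
  · rintro ⟨_, ⟨⟨k, g, hg, hk⟩, rfl⟩, rfl⟩
    exact ⟨⟨g, hg⟩, (subgraphHom_groupAction hk w).symm⟩

namespace RootPrebasis

variable {B : RootPrebasis M}

/-- A reflection with a finite orbit under `G` belongs to the parabolic subgroup of the finite
orbits of vertices: the support of the corresponding positive root is a union of finite orbits. -/
theorem IsReduced.exists_conj_of_finite_range (h : B.IsReduced) (hB : B.IsSymmetric G)
    {x : M.Group} {a : S}
    (hfin : (Set.range fun g : G =>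
      groupAction (g : symmetryGroup M) (x * M.simple a * x⁻¹)).Finite) :
    ∃ y ∈ standardParabolic M (finVertices G), ∃ s ∈ finVertices G,
      x * M.simple a * x⁻¹ = y * M.simple s * y⁻¹ := by
  obtain ⟨β, c, hβ⟩ : ∃ (β : B.posRoots) (c : M.Group),
      x * M.simple a * x⁻¹ = c * M.simple a * c⁻¹ ∧
        (β : S →₀ ℝ) = B.rep c (simpleRoot a) := by
    rcases h.nonneg_or_nonpos (B.rep_simpleRoot_mem_roots x a) with h0 | h0
    · exact ⟨⟨_, B.rep_simpleRoot_mem_roots x a, h0⟩, x, rfl, rfl⟩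
    · have e : B.rep (x * M.simple a) (simpleRoot a) = -B.rep x (simpleRoot a) := by
        rw [rep_mul_apply, rep_simple, reflection_simpleRoot, map_neg]
      refine ⟨⟨_, B.rep_simpleRoot_mem_roots (x * M.simple a) a, ?_⟩, _,
        h.conj_eq_conj_iff.2 (Or.inr ?_), rfl⟩
      · rw [e]; exact neg_nonneg.2 h0
      · rw [e, neg_neg]
  rw [hβ.1] at hfin ⊢
  have hfin' : (Set.range fun g : G => posRootAction hB g β).Finite :=
    finite_range_of_forall_eq hfin fun g k hgk => (hB.posRootAction_eq_iff h hβ.2 g k).2 hgk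
  have hsupp : ∀ r ∉ finVertices G, (β : S →₀ ℝ) r = 0 := by
    intro r hr
    by_contra hne
    refine hr ((hfin'.biUnion fun γ _ => (γ : S →₀ ℝ).support.finite_toSet).subset ?_)
    intro t ht
    obtain ⟨g, hg, rfl⟩ := mem_orbit_iff.1 ht
    refine Set.mem_biUnion (Set.mem_range_self (⟨g, hg⟩ : G)) ?_
    rw [Finset.mem_coe, Finsupp.mem_support_iff, coe_posRootAction, spaceAction_apply_apply]
    exact hne
  obtain ⟨y, hy, s, hs, e⟩ := h.exists_eq_rep_of_support β.2.1 β.2.2 hsupp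
  exact ⟨y, hy, s, hs, h.conj_eq_conj_iff.2 (Or.inl (hβ.2.symm.trans e))⟩

theorem IsReduced.finiteOrbitReflectionsFold_iff (h : B.IsReduced) (hB : B.IsSymmetric G) :
    FiniteOrbitReflectionsFold G ↔ FiniteOrbitReflectionsFold (finGroup G) := by
  have hinj := h.subgraphHom_injective (finVertices G)
  have hconj : ∀ (w : (finGraph G).Group) (s : finVertices G),
      subgraphHom M (finVertices G) (w * (finGraph G).simple s * w⁻¹) =
        subgraphHom M (finVertices G) w * M.simple (s : S) *
          (subgraphHom M (finVertices G) w)⁻¹ := fun w s => by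
    rw [map_mul, map_mul, map_inv, subgraphHom_simple]
  constructor
  · intro hfold x a hfin
    rw [← finite_range_subgraphHom_iff hinj, hconj] at hfin
    obtain ⟨w, hw, X, hX, s, hs, e⟩ := hfold _ _ hfin
    obtain ⟨w, rfl⟩ := exists_subgraphHom_eq (h.fixedSubgroup_le_standardParabolic G hw)
    classical
    have hX' : (X.subtype (· ∈ finVertices G)).map (Function.Embedding.subtype _) = X :=
      Finset.subtype_map_of_mem fun t ht => mem_finVertices_of_mem_admissibleOrbit hX ht
    refine ⟨w, (subgraphHom_mem_fixedSubgroup_iff hinj).1 hw, X.subtype (· ∈ finVertices G),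
      (map_mem_admissibleOrbits_iff hinj).1 (hX'.symm ▸ hX),
      ⟨s, mem_finVertices_of_mem_admissibleOrbit hX hs⟩, Finset.mem_subtype.2 hs, hinj ?_⟩
    rw [hconj, hconj, e]
  · intro hfold x a hfin
    obtain ⟨y, hy, s, hs, e⟩ := h.exists_conj_of_finite_range hB hfin
    obtain ⟨y, rfl⟩ := exists_subgraphHom_eq hy
    rw [e, ← hconj y ⟨s, hs⟩] at hfin ⊢
    rw [finite_range_subgraphHom_iff hinj] at hfin
    obtain ⟨w, hw, X, hX, t, ht, e2⟩ := hfold _ _ hfin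
    exact ⟨_, (subgraphHom_mem_fixedSubgroup_iff hinj).2 hw, _,
      (map_mem_admissibleOrbits_iff hinj).2 hX, t, Finset.mem_map_of_mem _ ht,
      by rw [e2, hconj]⟩

end RootPrebasis

end FiniteOrbits

end CoxeterSymmetry

end

theorem theorem2p9 {S : Type*} (M : CoxeterMatrix S)
    (G : Subgroup (CoxeterSymmetry.symmetryGroup M)) (K : Type*) [Field K]
    (B : CoxeterSymmetry.RootPrebasis M) (hred : B.IsReduced) (hsymm : B.IsSymmetric G)
    (B' : CoxeterSymmetry.RootPrebasis (CoxeterSymmetry.finGraph G)) (hred' : B'.IsReduced)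
    (hsymm' : B'.IsSymmetric (CoxeterSymmetry.finGroup G)) :
    CoxeterSymmetry.RootPrebasis.HasBasisProperty K hsymm ↔
      CoxeterSymmetry.RootPrebasis.HasBasisProperty K hsymm' := by
  rw [hred.hasBasisProperty_iff_finiteOrbitReflectionsFold hsymm,
    hred'.hasBasisProperty_iff_finiteOrbitReflectionsFold hsymm',
    hred.finiteOrbitReflectionsFold_iff hsymm]
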